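/- \textbf{Catalan groupoids.} Let $\mathbf I$ (resp. $\dot{\mathbf I}$) be the indiscrete (resp. discrete) category with objects $0,1$. Let $\mathbf A_1=\mathbf 1$ be the one-morphism category, and for $n\ge 2$ define the groupoid $\mathbf A_n$, with functors $U_{a,b}:\mathbf A_a\times\mathbf A_b\to\mathbf A_n$ ($a+b=n$) and $V_{i,j,k}:\mathbf A_i\times\mathbf A_j\times\mathbf A_k\times\mathbf I\to\mathbf A_n$ ($i+j+k=n$, all indices positive integers), as the pushout of categories of $$\coprod_{i+j+k=n}\mathbf A_i\times\mathbf A_j\times\mathbf A_k\times\mathbf I\;\hookleftarrow\;\coprod_{i+j+k=n}\mathbf A_i\times\mathbf A_j\times\mathbf A_k\times\dot{\mathbf I}\;\xrightarrow{\,W\,}\;\coprod_{a+b=n}\mathbf A_a\times\mathbf A_b ,$$ where $W(f,g,h,0)=(f,U_{j,k}(g,h))$ and $W(f,g,h,1)=(U_{i,j}(f,g),h)$. Write $f\otimes g=U_{a,b}(f,g)$. Thus the objects of $\mathbf A_n$ are the bracketings of $n$ letters, and its morphisms are generated by the reassociations $\langle i,j,k\rangle_{f,g,h}=V_{i,j,k}(\mathrm{Id}_f,\mathrm{Id}_g,\mathrm{Id}_h,0\to1):f\otimes(g\otimes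 h)\to(f\otimes g)\otimes h$ and their tensor products with identities. Let $\mathbf T_n$, with $L_n:\mathbf T_n\to\mathbf A_n$, be the maximal indiscrete subgroupoid obtained by the same inductive pushouts using only the triples with $j=1$. The fundamental group $\pi(\mathbf A_n)=\pi(\mathbf A_n,\mathbf T_n)$ is the pushout of $\mathbf A_n\xleftarrow{L_n}\mathbf T_n\to\mathbf 1$ in the category of small categories; a group is regarded as a one-object category, with $u*v$ meaning ``first $u$, then $v$''. \textbf{Generators and relations.} Consider symbols $X\langle i,j,k\rangle$ with $X$ in the free monoid on $\lambda,\rho$ and $i,j,k$ positive integers; for a word $Y$ put $Y\cdot X\langle i,j,k\rangle=(YX)\langle i,j,k\rangle$, and extend this to words in these symbols and their inverses letterwise. Put $G_1=R_1=\emptyset$ and, for $n\ge2$, $$G_n=\bigcup_{i=1}^{n-1}\big(\lambda^iG_{n-i}\cup\rho^{\,n-i}G_i\big)\cup\{\langle i,j,k\rangle:i+j+k=n\},$$ and let $R_n$ consist of the following relations: 1. for all $i+j+k=n$: $\langle i,j,k\rangle*\rho^k\rho^jx*\langle i,j,k\rangle^{-1}=\rho^{j+k}x$ for $x\in G_i$;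 $\langle i,j,k\rangle*\rho^k\lambda^iy*\langle i,j,k\rangle^{-1}=\lambda^i\rho^ky$ for $y\in G_j$; $\langle i,j,k\rangle*\lambda^{i+j}z*\langle i,j,k\rangle^{-1}=\lambda^i\lambda^jz$ for $z\in G_k$; 2. $\langle i,1,k\rangle=e$ for $i+1+k=n$; 3. $\lambda^iR_{n-i}$ and $\rho^{\,n-i}R_i$ for $1\le i\le n-1$; 4. $\rho^{\,n-i}x*\lambda^iy=\lambda^iy*\rho^{\,n-i}x$ for $1\le i\le n-1$, $x\in G_i$, $y\in G_{n-i}$. \textbf{Statement.} For every $n\ge1$ the category $\pi(\mathbf A_n)$ is a group and $\pi(\mathbf A_n)\cong\langle G_n\mid R_n\rangle$, by an isomorphism that sends the image in $\pi(\mathbf A_n)$ of every morphism of $\mathbf A_n$ of class $g\in G_n$ to the generator $g$. Here every $\langle i,j,k\rangle_{f,g,h}$ is of class $\langle i,j,k\rangle$, and if $\varepsilon$ is of class $g$ and $t$ is a bracketing of $a$ letters, then $\mathrm{Id}_t\otimes\varepsilon$ is of class $\lambda^ag$ and $\varepsilon\otimes\mathrm{Id}_t$ is of class $\rho^ag$.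 In particular $\pi(\mathbf A_3)$ is trivial, $\pi(\mathbf A_4)\cong\mathbb Z$, $\pi(\mathbf A_5)$ is free of rank $5$ and $\pi(\mathbf A_6)$ is free of rank $15$. -/

import Mathlib

open CategoryTheory CategoryTheory.Limits

namespace Catalan

/-! ### Associations and reassociations -/

/-- Associations of letters: elements of the free magma on one generator.
The number of letters is `FreeMagma.length`. -/
abbrev Tree : Type := FreeMagma Unit

/-- Formal reassociations. The predicate `P` on natural numbers restricts the basic reassociations
`x (y z) ⟶ (x y) z` to those whose middle factor `y` has a number of letters satisfying `P`. -/
inductive Word (P : ℕ → Prop) : Tree → Tree → Type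
  | id (x : Tree) : Word P x x
  | comp {x y z : Tree} (f : Word P x y) (g : Word P y z) : Word P x z
  | inv {x y : Tree} (f : Word P x y) : Word P y x
  | tensor {x y x' y' : Tree} (f : Word P x y) (g : Word P x' y') : Word P (x * x') (y * y')
  | assoc (x y z : Tree) (h : P y.length) : Word P (x * (y * z)) (x * y * z)

/-- The congruence on formal reassociations generated by the groupoid laws, the functoriality of
the tensor product and the naturality of the basic reassociations (and nothing else; in particular
no pentagon is made to commute). -/
inductive WordRel (P : ℕ → Prop) : ∀ {x y : Tree}, Word P x y → Word P x y → Prop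
  | refl {x y : Tree} (f : Word P x y) : WordRel P f f
  | symm {x y : Tree} {f g : Word P x y} : WordRel P f g → WordRel P g f
  | trans {x y : Tree} {f g h : Word P x y} : WordRel P f g → WordRel P g h → WordRel P f h
  | comp {x y z : Tree} {f f' : Word P x y} {g g' : Word P y z} :
      WordRel P f f' → WordRel P g g' → WordRel P (f.comp g) (f'.comp g')
  | inv {x y : Tree} {f f' : Word P x y} : WordRel P f f' → WordRel P f.inv f'.inv
  | tensor {x y x' y' : Tree} {f f' : Word P x y} {g g' : Word P x' y'} :
      WordRel P f f' → WordRel P g g' → WordRel P (f.tensor g) (f'.tensor g')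
  | id_comp {x y : Tree} (f : Word P x y) : WordRel P ((Word.id x).comp f) f
  | comp_id {x y : Tree} (f : Word P x y) : WordRel P (f.comp (Word.id y)) f
  | comp_assoc {x y z w : Tree} (f : Word P x y) (g : Word P y z) (h : Word P z w) :
      WordRel P ((f.comp g).comp h) (f.comp (g.comp h))
  | inv_comp {x y : Tree} (f : Word P x y) : WordRel P (f.inv.comp f) (Word.id y)
  | comp_inv {x y : Tree} (f : Word P x y) : WordRel P (f.comp f.inv) (Word.id x)
  | tensor_id (x y : Tree) : WordRel P ((Word.id x).tensor (Word.id y)) (Word.id (x * y))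
  | tensor_comp {x y z x' y' z' : Tree} (f : Word P x y) (g : Word P y z)
      (f' : Word P x' y') (g' : Word P y' z') :
      WordRel P ((f.comp g).tensor (f'.comp g')) ((f.tensor f').comp (g.tensor g'))
  | naturality {x y z x' y' z' : Tree} (f : Word P x x') (g : Word P y y') (h : Word P z z')
      (hy : P y.length) (hy' : P y'.length) :
      WordRel P ((f.tensor (g.tensor h)).comp (Word.assoc x' y' z' hy'))
        ((Word.assoc x y z hy).comp ((f.tensor g).tensor h))

/-- The setoid of the congruence. -/
def wordSetoid (P : ℕ → Prop) (x y : Tree) : Setoid (Word P x y) where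
  r := WordRel P
  iseqv := ⟨WordRel.refl, WordRel.symm, WordRel.trans⟩

/-- Reassociations of `x` into `y`. -/
def RHom (P : ℕ → Prop) (x y : Tree) : Type := Quotient (wordSetoid P x y)

namespace RHom

variable {P : ℕ → Prop}

/-- The reassociation given by a formal one. -/
def mk {x y : Tree} (f : Word P x y) : RHom P x y := Quotient.mk (wordSetoid P x y) f

/-- The identity. -/
def id (x : Tree) : RHom P x x := mk (Word.id x)

/-- Composition, in diagrammatic order. -/
def comp {x y z : Tree} (f : RHom P x y) (g : RHom P y z) : RHom P x z :=
  Quotient.map₂ Word.comp (fun _ _ h _ _ h' => WordRel.comp h h') f g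

/-- The inverse. -/
def inv {x y : Tree} (f : RHom P x y) : RHom P y x :=
  Quotient.map Word.inv (fun _ _ h => WordRel.inv h) f

/-- The tensor product. -/
def tensor {x y x' y' : Tree} (f : RHom P x y) (g : RHom P x' y') : RHom P (x * x') (y * y') :=
  Quotient.map₂ Word.tensor (fun _ _ h _ _ h' => WordRel.tensor h h') f g

/-- The basic reassociation. -/
def assoc (x y z : Tree) (h : P y.length) : RHom P (x * (y * z)) (x * y * z) :=
  mk (Word.assoc x y z h)

/-- Allowing more basic reassociations. -/
def _root_.Catalan.Word.mono {P Q : ℕ → Prop} (h : ∀ m, P m → Q m) :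
    ∀ {x y : Tree}, Word P x y → Word Q x y
  | _, _, .id x => .id x
  | _, _, .comp f g => .comp (f.mono h) (g.mono h)
  | _, _, .inv f => .inv (f.mono h)
  | _, _, .tensor f g => .tensor (f.mono h) (g.mono h)
  | _, _, .assoc x y z hy => .assoc x y z (h _ hy)

theorem _root_.Catalan.WordRel.mono {P Q : ℕ → Prop} (h : ∀ m, P m → Q m) {x y : Tree}
    {f g : Word P x y} (r : WordRel P f g) : WordRel Q (f.mono h) (g.mono h) := by
  induction r with
  | refl f => exact .refl _
  | symm _ ih => exact .symm ih
  | trans _ _ ih ih' => exact .trans ih ih'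
  | comp _ _ ih ih' => exact .comp ih ih'
  | inv _ ih => exact .inv ih
  | tensor _ _ ih ih' => exact .tensor ih ih'
  | id_comp f => exact .id_comp _
  | comp_id f => exact .comp_id _
  | comp_assoc f g h => exact .comp_assoc _ _ _
  | inv_comp f => exact .inv_comp _
  | comp_inv f => exact .comp_inv _
  | tensor_id x y => exact .tensor_id _ _
  | tensor_comp f g f' g' => exact .tensor_comp _ _ _ _
  | naturality f g h hy hy' => exact .naturality _ _ _ _ _

/-- Allowing more basic reassociations. -/
def mono {P Q : ℕ → Prop} (h : ∀ m, P m → Q m) {x y : Tree} (f : RHom P x y) : RHom Q x y :=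
  Quotient.map (Word.mono h) (fun _ _ r => WordRel.mono h r) f

end RHom

/-- Associations of `n` letters. -/
@[ext]
structure Obj (P : ℕ → Prop) (n : ℕ) where
  tree : Tree
  len : tree.length = n

/-- Associations of `n` letters and their reassociations (with middle factors restricted by `P`)
form a groupoid. -/
instance (P : ℕ → Prop) (n : ℕ) : Groupoid (Obj P n) where
  Hom x y := RHom P x.tree y.tree
  id x := RHom.id x.tree
  comp f g := RHom.comp f g
  inv f := RHom.inv f
  id_comp := by rintro _ _ ⟨f⟩; exact Quotient.sound (WordRel.id_comp f)
  comp_id := by rintro _ _ ⟨f⟩; exact Quotient.sound (WordRel.comp_id f)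
  assoc := by rintro _ _ _ _ ⟨f⟩ ⟨g⟩ ⟨h⟩; exact Quotient.sound (WordRel.comp_assoc f g h)
  inv_comp := by rintro _ _ ⟨f⟩; exact Quotient.sound (WordRel.inv_comp f)
  comp_inv := by rintro _ _ ⟨f⟩; exact Quotient.sound (WordRel.comp_inv f)

/-! ### The pushout squares -/

/-- Decompositions `a + b = n` into positive integers. -/
structure Split (n : ℕ) where
  a : ℕ
  b : ℕ
  ha : 0 < a
  hb : 0 < b
  sum : a + b = n

/-- Decompositions `i + j + k = n` into positive integers with `P j`. -/
structure Triple (P : ℕ → Prop) (n : ℕ) where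
  i : ℕ
  j : ℕ
  k : ℕ
  hi : 0 < i
  hj : 0 < j
  hk : 0 < k
  mid : P j
  sum : i + j + k = n

variable (P : ℕ → Prop)

/-- The tensor product of associations. -/
def U (a b n : ℕ) (h : a + b = n) : Obj P a × Obj P b ⥤ Obj P n where
  obj x := ⟨x.1.tree * x.2.tree, (congrArg₂ (· + ·) x.1.len x.2.len).trans h⟩
  map f := RHom.tensor f.1 f.2
  map_id x := Quotient.sound (WordRel.tensor_id _ _)
  map_comp := by
    rintro _ _ _ ⟨⟨f⟩, ⟨f'⟩⟩ ⟨⟨g⟩, ⟨g'⟩⟩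
    exact Quotient.sound (WordRel.tensor_comp f g f' g')

/-- `(f, g, h) ↦ f ⊗ (g ⊗ h)`, before the outer product is taken. -/
def W₀ (n : ℕ) (t : Triple P n) :
    Obj P t.i × Obj P t.j × Obj P t.k ⥤ Obj P t.i × Obj P (t.j + t.k) :=
  (𝟭 (Obj P t.i)).prod (U P t.j t.k (t.j + t.k) rfl)

/-- `(f, g, h) ↦ (f ⊗ g) ⊗ h`, before the outer product is taken. -/
def W₁ (n : ℕ) (t : Triple P n) :
    Obj P t.i × Obj P t.j × Obj P t.k ⥤ Obj P (t.i + t.j) × Obj P t.k :=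
  (prod.inverseAssociator _ _ _) ⋙ (U P t.i t.j (t.i + t.j) rfl).prod (𝟭 (Obj P t.k))

/-- The splitting of the values of `W₀`. -/
def Triple.split₀ {P : ℕ → Prop} {n : ℕ} (t : Triple P n) : Split n :=
  ⟨t.i, t.j + t.k, t.hi, Nat.add_pos_left t.hj _, by rw [← Nat.add_assoc, t.sum]⟩

/-- The splitting of the values of `W₁`. -/
def Triple.split₁ {P : ℕ → Prop} {n : ℕ} (t : Triple P n) : Split n :=
  ⟨t.i + t.j, t.k, Nat.add_pos_left t.hi _, t.hk, t.sum⟩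

/-- `∐ A_a × A_b` over `a + b = n`. -/
abbrev Pairs (n : ℕ) : Type := Σ s : Split n, Obj P s.a × Obj P s.b

/-- `∐ A_i × A_j × A_k × İ` over `i + j + k = n`. -/
abbrev TriplesDisc (n : ℕ) : Type :=
  Σ t : Triple P n, (Obj P t.i × Obj P t.j × Obj P t.k) × Discrete Bool

/-- `∐ A_i × A_j × A_k × I` over `i + j + k = n`. -/
abbrev TriplesCodisc (n : ℕ) : Type :=
  Σ t : Triple P n, (Obj P t.i × Obj P t.j × Obj P t.k) × Codiscrete Bool

/-- Two functors `C ⥤ D` as a functor `C × İ ⥤ D` with value `F` at `0` and `G` at `1`. The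
endpoint `0` is `false` and the endpoint `1` is `true`. -/
def endpoints {C D : Type} [Category.{0} C] [Category.{0} D] (F G : C ⥤ D) :
    C × Discrete Bool ⥤ D where
  obj x := match x.2.as with
    | false => F.obj x.1
    | true => G.obj x.1
  map {x y} f := match x, y, f with
    | (_, ⟨false⟩), (_, ⟨false⟩), f => F.map f.1
    | (_, ⟨false⟩), (_, ⟨true⟩), f => absurd (Discrete.eq_of_hom f.2) Bool.false_ne_true
    | (_, ⟨true⟩), (_, ⟨false⟩), f => absurd (Discrete.eq_of_hom f.2).symm Bool.false_ne_true
    | (_, ⟨true⟩), (_, ⟨true⟩), f => G.map f.1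
  map_id := by rintro ⟨x, ⟨_ | _⟩⟩ <;> simp
  map_comp := by
    rintro ⟨x, ⟨_ | _⟩⟩ ⟨y, ⟨_ | _⟩⟩ ⟨z, ⟨_ | _⟩⟩ ⟨f, f'⟩ ⟨g, g'⟩
    all_goals first
      | exact Bool.noConfusion (Discrete.eq_of_hom f')
      | exact Bool.noConfusion (Discrete.eq_of_hom g')
      | simp

/-- The component of `W`. -/
def WComp (n : ℕ) (t : Triple P n) :
    (Obj P t.i × Obj P t.j × Obj P t.k) × Discrete Bool ⥤ Pairs P n :=
  endpoints
    (W₀ P n t ⋙ Sigma.incl (C := fun s : Split n => Obj P s.a × Obj P s.b) t.split₀)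
    (W₁ P n t ⋙ Sigma.incl (C := fun s : Split n => Obj P s.a × Obj P s.b) t.split₁)

/-- The basic reassociations `f ⊗ (g ⊗ h) ≅ (f ⊗ g) ⊗ h` form a natural isomorphism. -/
def assocIso (n : ℕ) (t : Triple P n) :
    W₀ P n t ⋙ U P t.i (t.j + t.k) n t.split₀.sum ≅
      W₁ P n t ⋙ U P (t.i + t.j) t.k n t.split₁.sum :=
  NatIso.ofComponents
    (fun x => Groupoid.isoEquivHom _ _ |>.symm
      (RHom.assoc x.1.tree x.2.1.tree x.2.2.tree (by rw [x.2.1.len]; exact t.mid)))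
    (by
      rintro ⟨x, y, z⟩ ⟨x', y', z'⟩ ⟨⟨f⟩, ⟨g⟩, ⟨h⟩⟩
      exact Quotient.sound (WordRel.naturality f g h _ _))

/-- A natural isomorphism `F ≅ G` of functors `C ⥤ D` as a functor `C × I ⥤ D` with value `F` at
`0` and `G` at `1`. -/
def cylinder {C D : Type} [Category.{0} C] [Category.{0} D] {F G : C ⥤ D} (e : F ≅ G) :
    C × Codiscrete Bool ⥤ D where
  obj x := match x.2.as with
    | false => F.obj x.1
    | true => G.obj x.1
  map {x y} f := match x, y, f with
    | (_, ⟨false⟩), (_, ⟨false⟩), f => F.map f.1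
    | (x, ⟨false⟩), (_, ⟨true⟩), f => e.hom.app x ≫ G.map f.1
    | (x, ⟨true⟩), (_, ⟨false⟩), f => e.inv.app x ≫ F.map f.1
    | (_, ⟨true⟩), (_, ⟨true⟩), f => G.map f.1
  map_id := by rintro ⟨x, ⟨_ | _⟩⟩ <;> simp
  map_comp := by
    rintro ⟨x, ⟨_ | _⟩⟩ ⟨y, ⟨_ | _⟩⟩ ⟨z, ⟨_ | _⟩⟩ ⟨f, _⟩ ⟨g, _⟩ <;> simp

/-- The component of `V`. -/
def VComp (n : ℕ) (t : Triple P n) :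
    (Obj P t.i × Obj P t.j × Obj P t.k) × Codiscrete Bool ⥤ Obj P n :=
  cylinder (assocIso P n t)

/-- The upper horizontal functor of the pushout square. -/
def WFun (n : ℕ) : TriplesDisc P n ⥤ Pairs P n := Sigma.desc (WComp P n)

/-- The inclusion of the endpoints. -/
def ends (n : ℕ) : TriplesDisc P n ⥤ TriplesCodisc P n :=
  Sigma.desc fun t => (𝟭 (Obj P t.i × Obj P t.j × Obj P t.k)).prod (Discrete.functor Codiscrete.mk) ⋙
    Sigma.incl (C := fun t : Triple P n =>
      (Obj P t.i × Obj P t.j × Obj P t.k) × Codiscrete Bool) t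

/-- The right vertical functor of the pushout square. -/
def UFun (n : ℕ) : Pairs P n ⥤ Obj P n := Sigma.desc fun s => U P s.a s.b n s.sum

/-- The lower horizontal functor of the pushout square. -/
def VFun (n : ℕ) : TriplesCodisc P n ⥤ Obj P n := Sigma.desc (VComp P n)

section Heq

variable {C : Type} [Category.{0} C]

theorem comp_heq {X Y Z X' Y' Z' : C} {f : X ⟶ Y} {g : Y ⟶ Z} {f' : X' ⟶ Y'} {g' : Y' ⟶ Z'}
    (hX : X = X') (hY : Y = Y') (hZ : Z = Z') (hf : f ≍ f') (hg : g ≍ g') :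
    f ≫ g ≍ f' ≫ g' := by
  subst hX hY hZ; cases hf; cases hg; rfl

theorem inv_heq {X Y X' Y' : C} {e : X ≅ Y} {e' : X' ≅ Y'}
    (hX : X = X') (hY : Y = Y') (h : e.hom ≍ e'.hom) : e.inv ≍ e'.inv := by
  subst hX hY
  obtain rfl : e = e' := Iso.ext (eq_of_heq h)
  rfl

theorem id_heq {X X' : C} (hX : X = X') : 𝟙 X ≍ 𝟙 X' := by subst hX; rfl

theorem conj_heq {X Y X' Y' : C} (hX : X = X') (hY : Y' = Y) (f : X' ⟶ Y') :
    (eqToIso hX).hom ≫ f ≫ (eqToIso hY).hom ≍ f := by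
  subst hX hY; simp

end Heq

theorem sigma_ext {I : Type} {C : I → Type} [∀ i, Category.{0} (C i)] {D : Type} [Category.{0} D]
    {F G : (Σ i, C i) ⥤ D} (h : ∀ i, Sigma.incl i ⋙ F = Sigma.incl i ⋙ G) : F = G := by
  refine CategoryTheory.Functor.hext ?_ ?_
  · rintro ⟨i, x⟩
    exact Functor.congr_obj (h i) x
  · rintro ⟨i, x⟩ ⟨_, y⟩ ⟨f⟩
    exact Functor.hcongr_hom (h i) f

theorem disc_ext {C D : Type} [Category.{0} C] [Category.{0} D] {F G : C × Discrete Bool ⥤ D}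
    (h : ∀ b, Prod.sectL C (Discrete.mk b) ⋙ F = Prod.sectL C (Discrete.mk b) ⋙ G) : F = G := by
  refine CategoryTheory.Functor.hext ?_ ?_
  · rintro ⟨x, ⟨b⟩⟩
    exact Functor.congr_obj (h b) x
  · rintro ⟨x, ⟨b⟩⟩ ⟨y, ⟨c⟩⟩ ⟨f, g⟩
    obtain rfl : b = c := Discrete.eq_of_hom g
    obtain rfl : g = 𝟙 _ := Subsingleton.elim _ _
    exact Functor.hcongr_hom (h b) f

theorem square_comm (n : ℕ) : WFun P n ⋙ UFun P n = ends P n ⋙ VFun P n := by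
  refine sigma_ext fun t => disc_ext ?_
  rintro (_ | _) <;> rfl

/-- The morphism `f × (b ⟶ c)` of `C × I`. -/
def cylHom {C : Type} [Category.{0} C] {x y : C} (f : x ⟶ y) (b c : Bool) :
    ((x, ⟨b⟩) : C × Codiscrete Bool) ⟶ (y, ⟨c⟩) := (f, ())

theorem cyl_ext {C D : Type} [Category.{0} C] [Category.{0} D] {F G : C × Codiscrete Bool ⥤ D}
    (h : ∀ b, Prod.sectL C (Codiscrete.mk b) ⋙ F = Prod.sectL C (Codiscrete.mk b) ⋙ G)
    (h' : ∀ x : C, F.map (cylHom (𝟙 x) false true) ≍ G.map (cylHom (𝟙 x) false true)) :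
    F = G := by
  have ho : ∀ x, F.obj x = G.obj x := fun x => Functor.congr_obj (h x.2.as) x.1
  have hb : ∀ (x : C) (b : Bool),
      F.map (cylHom (𝟙 x) b b) ≍ G.map (cylHom (𝟙 x) b b) := fun x b =>
    Functor.hcongr_hom (h b) (𝟙 x)
  have h'' : ∀ x : C, F.map (cylHom (𝟙 x) true false) ≍ G.map (cylHom (𝟙 x) true false) := by
    intro x
    let e : ((x, ⟨false⟩) : C × Codiscrete Bool) ≅ (x, ⟨true⟩) :=
      ⟨cylHom (𝟙 x) false true, cylHom (𝟙 x) true false,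
        Prod.ext (Category.comp_id _) rfl, Prod.ext (Category.comp_id _) rfl⟩
    exact inv_heq (e := F.mapIso e) (e' := G.mapIso e) (ho _) (ho _) (h' x)
  refine CategoryTheory.Functor.hext ho ?_
  rintro ⟨x, ⟨b⟩⟩ ⟨y, ⟨c⟩⟩ ⟨f, ⟨⟩⟩
  have key : ((f, ()) : ((x, ⟨b⟩) : C × Codiscrete Bool) ⟶ (y, ⟨c⟩)) =
      cylHom (𝟙 x) b c ≫ cylHom f c c := Prod.ext (Category.id_comp _).symm rfl
  have hc : F.map (cylHom f c c) ≍ G.map (cylHom f c c) := Functor.hcongr_hom (h c) f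
  change F.map (f, ()) ≍ G.map (f, ())
  rw [key, F.map_comp, G.map_comp]
  refine comp_heq (ho _) (ho _) (ho _) ?_ hc
  rcases b with _ | _ <;> rcases c with _ | _
  · exact hb x _
  · exact h' x
  · exact h'' x
  · exact hb x _

/-- The outermost multiplication of an association of at least two letters. -/
def dec {n : ℕ} (hn : 2 ≤ n) : ∀ (x : Tree), x.length = n → Pairs P n
  | .of _, h => absurd (show 1 = n from h) (by omega)
  | .mul x y, h => ⟨⟨x.length, y.length, x.length_pos, y.length_pos, h⟩, ⟨x, rfl⟩, ⟨y, rfl⟩⟩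

theorem dec_mul {n : ℕ} (hn : 2 ≤ n) (x y : Tree) (h : (x * y).length = n) (s : Split n)
    (hx : x.length = s.a) (hy : y.length = s.b) :
    dec P hn (x * y) h = ⟨s, ⟨x, hx⟩, ⟨y, hy⟩⟩ := by
  obtain ⟨a, b, _, _, _⟩ := s
  dsimp only at hx hy
  subst hx
  subst hy
  rfl

theorem UFun_dec {n : ℕ} (hn : 2 ≤ n) (x : Obj P n) :
    (UFun P n).obj (dec P hn x.tree x.len) = x := by
  obtain ⟨x, h⟩ := x
  rcases x with _ | ⟨x, y⟩
  · exact absurd (show 1 = n from h) (by omega)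
  · rfl

theorem Word.length_eq {P : ℕ → Prop} {x y : Tree} (f : Word P x y) : x.length = y.length := by
  induction f with
  | id => rfl
  | comp _ _ h h' => exact h.trans h'
  | inv _ h => exact h.symm
  | tensor _ _ h h' => exact congrArg₂ (· + ·) h h'
  | assoc x y z _ => exact (Nat.add_assoc _ _ _).symm

/-- A reassociation as a morphism of the groupoid. -/
def toHom {P : ℕ → Prop} {n : ℕ} {x y : Tree} (f : Word P x y) (hx : x.length = n)
    (hy : y.length = n) : (⟨x, hx⟩ : Obj P n) ⟶ ⟨y, hy⟩ := RHom.mk f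

/-- The splitting of a product. -/
def Split.ofMul {n : ℕ} (x y : Tree) (h : (x * y).length = n) : Split n :=
  ⟨x.length, y.length, x.length_pos, y.length_pos, h⟩

/-- The splitting of a threefold product. -/
def Triple.ofMul {P : ℕ → Prop} {n : ℕ} (x y z : Tree) (hy : P y.length)
    (h : (x * y * z).length = n) : Triple P n :=
  ⟨x.length, y.length, z.length, x.length_pos, y.length_pos, z.length_pos, hy, h⟩

/-- A pair of reassociations as a morphism of the coproduct. -/
def pairHom {P : ℕ → Prop} {n : ℕ} (s : Split n) {x y x' y' : Tree} (f : Word P x y)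
    (g : Word P x' y') (hx : x.length = s.a) (hx' : x'.length = s.b) :
    (⟨s, ⟨x, hx⟩, ⟨x', hx'⟩⟩ : Pairs P n) ⟶
      ⟨s, ⟨y, f.length_eq.symm.trans hx⟩, ⟨y', g.length_eq.symm.trans hx'⟩⟩ :=
  Sigma.SigmaHom.mk (toHom f _ _, toHom g _ _)

/-- The object `((x, y, z), b)` of the coproduct. -/
def triObj {P : ℕ → Prop} {n : ℕ} (t : Triple P n) (x : Obj P t.i) (y : Obj P t.j) (z : Obj P t.k)
    (b : Bool) : TriplesCodisc P n := ⟨t, (x, y, z), ⟨b⟩⟩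

/-- The morphism `((f, g, h), b ⟶ c)` of the coproduct. -/
def triHom {P : ℕ → Prop} {n : ℕ} (t : Triple P n) {x x' : Obj P t.i} {y y' : Obj P t.j}
    {z z' : Obj P t.k} (f : x ⟶ x') (g : y ⟶ y') (h : z ⟶ z') (b c : Bool) :
    triObj t x y z b ⟶ triObj t x' y' z' c :=
  Sigma.SigmaHom.mk ((f, g, h), ())

theorem triHom_comp {P : ℕ → Prop} {n : ℕ} (t : Triple P n) {x x' x'' : Obj P t.i}
    {y y' y'' : Obj P t.j} {z z' z'' : Obj P t.k} (f : x ⟶ x') (g : y ⟶ y') (h : z ⟶ z')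
    (f' : x' ⟶ x'') (g' : y' ⟶ y'') (h' : z' ⟶ z'') (b c d : Bool) :
    triHom t f g h b c ≫ triHom t f' g' h' c d = triHom t (f ≫ f') (g ≫ g') (h ≫ h') b d := rfl

theorem VFun_assoc {n : ℕ} (t : Triple P n) (x : Obj P t.i) (y : Obj P t.j) (z : Obj P t.k) :
    (VFun P n).map (triHom t (𝟙 x) (𝟙 y) (𝟙 z) false true) =
      (assocIso P n t).hom.app (x, y, z) := by
  change (assocIso P n t).hom.app (x, y, z) ≫ (W₁ P n t ⋙ U P _ _ n _).map (𝟙 (x, y, z)) = _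
  rw [CategoryTheory.Functor.map_id, Category.comp_id]

theorem hom_ext {n : ℕ} (hn : 2 ≤ n) {C : Type} [Category.{0} C] {F G : Obj P n ⥤ C}
    (hU : UFun P n ⋙ F = UFun P n ⋙ G) (hV : VFun P n ⋙ F = VFun P n ⋙ G) : F = G := by
  have ho : ∀ x, F.obj x = G.obj x := fun x => by
    rw [← UFun_dec P hn x]; exact Functor.congr_obj hU _
  refine CategoryTheory.Functor.hext ho ?_
  have key : ∀ {x y : Tree} (f : Word P x y) (hx : x.length = n) (hy : y.length = n),
      F.map (toHom f hx hy) ≍ G.map (toHom f hx hy) := by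
    intro x y f
    induction f with
    | id x =>
      intro hx _
      have e : toHom (Word.id x) hx hx = 𝟙 (⟨x, hx⟩ : Obj P n) := rfl
      rw [e, F.map_id, G.map_id]
      exact id_heq (ho _)
    | @comp x y z f g ihf ihg =>
      intro hx hz
      have hy : y.length = n := f.length_eq.symm.trans hx
      have e : toHom (f.comp g) hx hz = toHom f hx hy ≫ toHom g hy hz := rfl
      rw [e, F.map_comp, G.map_comp]
      exact comp_heq (ho _) (ho _) (ho _) (ihf hx hy) (ihg hy hz)
    | @inv x y f ih =>
      intro hy hx
      let e : (⟨x, hx⟩ : Obj P n) ≅ ⟨y, hy⟩ := (Groupoid.isoEquivHom _ _).symm (toHom f hx hy)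
      exact inv_heq (e := F.mapIso e) (e' := G.mapIso e) (ho _) (ho _) (ih hx hy)
    | @tensor x y x' y' f g _ _ =>
      intro hx hy
      exact Functor.hcongr_hom hU (pairHom (Split.ofMul x x' hx) f g rfl rfl)
    | assoc x y z h =>
      intro hx hy
      have e := Functor.hcongr_hom hV (triHom (Triple.ofMul x y z h hy)
        (𝟙 ⟨x, rfl⟩) (𝟙 ⟨y, rfl⟩) (𝟙 ⟨z, rfl⟩) false true)
      rw [Functor.comp_map, Functor.comp_map, VFun_assoc] at e
      exact e
  rintro ⟨x, hx⟩ ⟨y, hy⟩ ⟨f⟩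
  exact key f hx hy

section Lift

variable {P} {n : ℕ} (hn : 2 ≤ n) {C : Type} [Category.{0} C] (Φ : Pairs P n ⥤ C)
  (Ψ : TriplesCodisc P n ⥤ C) (comm : WFun P n ⋙ Φ = ends P n ⋙ Ψ)

theorem lift_obj₀ {P : ℕ → Prop} {n : ℕ} (hn : 2 ≤ n) {C : Type} [Category.{0} C]
    {Φ : Pairs P n ⥤ C} {Ψ : TriplesCodisc P n ⥤ C} (comm : WFun P n ⋙ Φ = ends P n ⋙ Ψ)
    (x y z : Tree) (hx : (x * (y * z)).length = n)
    (t : Triple P n) (h₁ : x.length = t.i) (h₂ : y.length = t.j) (h₃ : z.length = t.k) :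
    Φ.obj (dec P hn (x * (y * z)) hx) = Ψ.obj (triObj t ⟨x, h₁⟩ ⟨y, h₂⟩ ⟨z, h₃⟩ false) := by
  rw [dec_mul P hn _ _ _ t.split₀ h₁ (congrArg₂ (· + ·) h₂ h₃)]
  exact Functor.congr_obj comm ⟨t, (⟨x, h₁⟩, ⟨y, h₂⟩, ⟨z, h₃⟩), ⟨false⟩⟩

theorem lift_obj₁ {P : ℕ → Prop} {n : ℕ} (hn : 2 ≤ n) {C : Type} [Category.{0} C]
    {Φ : Pairs P n ⥤ C} {Ψ : TriplesCodisc P n ⥤ C} (comm : WFun P n ⋙ Φ = ends P n ⋙ Ψ)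
    (x y z : Tree) (hx : (x * y * z).length = n)
    (t : Triple P n) (h₁ : x.length = t.i) (h₂ : y.length = t.j) (h₃ : z.length = t.k) :
    Φ.obj (dec P hn (x * y * z) hx) = Ψ.obj (triObj t ⟨x, h₁⟩ ⟨y, h₂⟩ ⟨z, h₃⟩ true) := by
  rw [dec_mul P hn _ _ _ t.split₁ (congrArg₂ (· + ·) h₁ h₂) h₃]
  exact Functor.congr_obj comm ⟨t, (⟨x, h₁⟩, ⟨y, h₂⟩, ⟨z, h₃⟩), ⟨true⟩⟩

/-- The isomorphism `((x, y, z), 0) ≅ ((x, y, z), 1)`. -/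
def triIso {P : ℕ → Prop} {n : ℕ} (t : Triple P n) (x : Obj P t.i) (y : Obj P t.j)
    (z : Obj P t.k) : triObj t x y z false ≅ triObj t x y z true where
  hom := triHom t (𝟙 x) (𝟙 y) (𝟙 z) false true
  inv := triHom t (𝟙 x) (𝟙 y) (𝟙 z) true false
  hom_inv_id := by rw [triHom_comp]; simp only [Category.comp_id]; rfl
  inv_hom_id := by rw [triHom_comp]; simp only [Category.comp_id]; rfl

/-- A pair of reassociations as an isomorphism of the coproduct. -/
def pairIso {P : ℕ → Prop} {n : ℕ} (s : Split n) {x y x' y' : Tree} (f : Word P x y)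
    (g : Word P x' y') (hx : x.length = s.a) (hx' : x'.length = s.b) :
    (⟨s, ⟨x, hx⟩, ⟨x', hx'⟩⟩ : Pairs P n) ≅
      ⟨s, ⟨y, f.length_eq.symm.trans hx⟩, ⟨y', g.length_eq.symm.trans hx'⟩⟩ :=
  (Sigma.incl (C := fun s : Split n => Obj P s.a × Obj P s.b) s).mapIso
    (Iso.prod ((Groupoid.isoEquivHom _ _).symm (toHom f hx _))
      ((Groupoid.isoEquivHom _ _).symm (toHom g hx' _)))

/-- The functor out of the pushout, on formal reassociations. -/
def liftWord : ∀ {x y : Tree} (_ : Word P x y) (hx : x.length = n) (hy : y.length = n),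
    Φ.obj (dec P hn x hx) ≅ Φ.obj (dec P hn y hy)
  | _, _, .id _, _, _ => Iso.refl _
  | _, _, .comp f g, hx, hz =>
    liftWord f hx (f.length_eq.symm.trans hx) ≪≫ liftWord g (f.length_eq.symm.trans hx) hz
  | _, _, .inv f, hx, hy => (liftWord f hy hx).symm
  | _, _, .tensor (x := x) (x' := x') f g, hx, hy =>
    eqToIso (congrArg Φ.obj (dec_mul P hn _ _ _ (Split.ofMul x x' hx) rfl rfl)) ≪≫
      Φ.mapIso (pairIso (Split.ofMul x x' hx) f g rfl rfl) ≪≫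
      eqToIso (congrArg Φ.obj (dec_mul P hn _ _ hy (Split.ofMul x x' hx)
        f.length_eq.symm g.length_eq.symm).symm)
  | _, _, .assoc x y z h, hx, hy =>
    eqToIso (lift_obj₀ hn comm x y z hx (Triple.ofMul x y z h hy) rfl rfl rfl) ≪≫
      Ψ.mapIso (triIso (Triple.ofMul x y z h hy) ⟨x, rfl⟩ ⟨y, rfl⟩ ⟨z, rfl⟩) ≪≫
      eqToIso (lift_obj₁ hn comm x y z hy (Triple.ofMul x y z h hy) rfl rfl rfl).symm

theorem liftWord_tensor {x y x' y' : Tree} (f : Word P x y) (g : Word P x' y')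
    (hx : (x * x').length = n) (hy : (y * y').length = n)
    (s : Split n) (h : x.length = s.a) (h' : x'.length = s.b) :
    (liftWord hn Φ Ψ comm (.tensor f g) hx hy).hom ≍ Φ.map (pairHom s f g h h') := by
  obtain ⟨a, b, _, _, _⟩ := s
  dsimp only at h h'
  subst h
  subst h'
  exact conj_heq _ _ _

theorem liftWord_assoc (x y z : Tree) (h : P y.length)
    (hx : (x * (y * z)).length = n) (hy : (x * y * z).length = n)
    (t : Triple P n) (h₁ : x.length = t.i) (h₂ : y.length = t.j) (h₃ : z.length = t.k) :
    (liftWord hn Φ Ψ comm (.assoc x y z h) hx hy).hom ≍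
      Ψ.map (triHom t (𝟙 ⟨x, h₁⟩) (𝟙 ⟨y, h₂⟩) (𝟙 ⟨z, h₃⟩) false true) := by
  obtain ⟨i, j, k, _, _, _, _, _⟩ := t
  dsimp only at h₁ h₂ h₃
  subst h₁
  subst h₂
  subst h₃
  exact conj_heq _ _ _

theorem pairHom_congr {s : Split n} {x y x' y' : Tree} {f f₁ : Word P x y} {g g₁ : Word P x' y'}
    (hf : WordRel P f f₁) (hg : WordRel P g g₁) (h : x.length = s.a) (h' : x'.length = s.b) :
    pairHom s f g h h' = pairHom s f₁ g₁ h h' := by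
  have e : toHom f h (f.length_eq.symm.trans h) = toHom f₁ h (f.length_eq.symm.trans h) :=
    Quotient.sound hf
  have e' : toHom g h' (g.length_eq.symm.trans h') = toHom g₁ h' (g.length_eq.symm.trans h') :=
    Quotient.sound hg
  unfold pairHom
  rw [e, e']

theorem liftWord_rel {x y : Tree} {f g : Word P x y} (r : WordRel P f g) :
    ∀ (hx : x.length = n) (hy : y.length = n),
      (liftWord hn Φ Ψ comm f hx hy).hom = (liftWord hn Φ Ψ comm g hx hy).hom := by
  induction r with
  | refl f => intros; rfl
  | symm _ ih => intro hx hy; exact (ih hx hy).symm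
  | trans _ _ ih ih' => intro hx hy; exact (ih hx hy).trans (ih' hx hy)
  | comp _ _ ih ih' =>
    intro hx hz
    simp only [liftWord, Iso.trans_hom]
    rw [ih, ih']
  | inv _ ih =>
    intro hx hy
    simp only [liftWord, Iso.symm_hom]
    rw [Iso.ext (ih hy hx)]
  | @tensor x y x' y' f f' g g' hf hg _ _ =>
    intro hx hy
    have h₁ := liftWord_tensor hn Φ Ψ comm f g hx hy (Split.ofMul x x' hx) rfl rfl
    have h₂ := liftWord_tensor hn Φ Ψ comm f' g' hx hy (Split.ofMul x x' hx) rfl rfl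
    have e := pairHom_congr (s := Split.ofMul x x' hx) hf hg rfl rfl
    exact eq_of_heq ((h₁.trans (heq_of_eq (congrArg Φ.map e))).trans h₂.symm)
  | id_comp f => intros; exact Category.id_comp _
  | comp_id f => intros; exact Category.comp_id _
  | comp_assoc f g h => intros; exact Category.assoc _ _ _
  | inv_comp f => intros; exact Iso.inv_hom_id _
  | comp_inv f => intros; exact Iso.hom_inv_id _
  | tensor_id x y =>
    intro hx hy
    refine eq_of_heq ((liftWord_tensor hn Φ Ψ comm _ _ hx hy (Split.ofMul x y hx) rfl rfl).trans ?_)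
    exact heq_of_eq (Φ.map_id _)
  | @tensor_comp x y z x' y' z' f g f' g' =>
    intro hx hz
    have hy : (y * y').length = n := (f.tensor f').length_eq.symm.trans hx
    refine eq_of_heq ((liftWord_tensor hn Φ Ψ comm _ _ hx hz
      (Split.ofMul x x' hx) rfl rfl).trans ?_)
    have e : pairHom (n := n) (Split.ofMul x x' hx) (f.comp g) (f'.comp g') rfl rfl =
      pairHom (Split.ofMul x x' hx) f f' rfl rfl ≫ pairHom (Split.ofMul x x' hx) g g'
        f.length_eq.symm f'.length_eq.symm := rfl
    rw [e, Φ.map_comp]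
    refine comp_heq ?_ ?_ ?_ (liftWord_tensor hn Φ Ψ comm _ _ hx hy _ _ _).symm
      (liftWord_tensor hn Φ Ψ comm _ _ hy hz _ _ _).symm
    · exact congrArg Φ.obj (dec_mul P hn _ _ _ _ _ _).symm
    · exact congrArg Φ.obj (dec_mul P hn _ _ _ _ _ _).symm
    · exact congrArg Φ.obj (dec_mul P hn _ _ _ _ _ _).symm
  | @naturality x y z x' y' z' f g h hy hy' =>
    intro h₀ h₁
    have hm : (x' * (y' * z')).length = n := (f.tensor (g.tensor h)).length_eq.symm.trans h₀
    have hm' : (x * y * z).length = n := ((f.tensor g).tensor h).length_eq.trans h₁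
    let t := Triple.ofMul (n := n) x y z hy hm'
    let f' : (⟨x, rfl⟩ : Obj P t.i) ⟶ ⟨x', f.length_eq.symm⟩ := toHom f _ _
    let g' : (⟨y, rfl⟩ : Obj P t.j) ⟶ ⟨y', g.length_eq.symm⟩ := toHom g _ _
    let h' : (⟨z, rfl⟩ : Obj P t.k) ⟶ ⟨z', h.length_eq.symm⟩ := toHom h _ _
    have a₀ : (liftWord hn Φ Ψ comm (f.tensor (g.tensor h)) h₀ hm).hom ≍
        Ψ.map (triHom t f' g' h' false false) :=
      (liftWord_tensor hn Φ Ψ comm f (g.tensor h) h₀ hm t.split₀ rfl rfl).trans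
        (Functor.hcongr_hom comm (X := ⟨t, (⟨x, rfl⟩, ⟨y, rfl⟩, ⟨z, rfl⟩), ⟨false⟩⟩)
          (Y := ⟨t, (⟨x', f.length_eq.symm⟩, ⟨y', g.length_eq.symm⟩, ⟨z', h.length_eq.symm⟩),
            ⟨false⟩⟩) (Sigma.SigmaHom.mk ((f', g', h'), 𝟙 _)))
    have a₁ : (liftWord hn Φ Ψ comm ((f.tensor g).tensor h) hm' h₁).hom ≍
        Ψ.map (triHom t f' g' h' true true) :=
      (liftWord_tensor hn Φ Ψ comm (f.tensor g) h hm' h₁ t.split₁ rfl rfl).trans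
        (Functor.hcongr_hom comm (X := ⟨t, (⟨x, rfl⟩, ⟨y, rfl⟩, ⟨z, rfl⟩), ⟨true⟩⟩)
          (Y := ⟨t, (⟨x', f.length_eq.symm⟩, ⟨y', g.length_eq.symm⟩, ⟨z', h.length_eq.symm⟩),
            ⟨true⟩⟩) (Sigma.SigmaHom.mk ((f', g', h'), 𝟙 _)))
    have b₀ := liftWord_assoc hn Φ Ψ comm x y z hy h₀ hm' t rfl rfl rfl
    have b₁ := liftWord_assoc hn Φ Ψ comm x' y' z' hy' hm h₁ t f.length_eq.symm
      g.length_eq.symm h.length_eq.symm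
    have l := comp_heq (lift_obj₀ hn comm x y z h₀ t rfl rfl rfl)
      (lift_obj₀ hn comm x' y' z' hm t f.length_eq.symm g.length_eq.symm h.length_eq.symm)
      (lift_obj₁ hn comm x' y' z' h₁ t f.length_eq.symm g.length_eq.symm h.length_eq.symm) a₀ b₁
    have r := comp_heq (lift_obj₀ hn comm x y z h₀ t rfl rfl rfl)
      (lift_obj₁ hn comm x y z hm' t rfl rfl rfl)
      (lift_obj₁ hn comm x' y' z' h₁ t f.length_eq.symm g.length_eq.symm h.length_eq.symm) b₀ a₁
    rw [← Ψ.map_comp, triHom_comp] at l r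
    simp only [Category.comp_id] at l
    simp only [Category.id_comp] at r
    exact eq_of_heq (l.trans r.symm)

/-- The functor out of the pushout. -/
def lift : Obj P n ⥤ C where
  obj x := Φ.obj (dec P hn x.tree x.len)
  map {x y} f := Quotient.lift (fun w : Word P x.tree y.tree =>
    (liftWord hn Φ Ψ comm w x.len y.len).hom) (fun _ _ r => liftWord_rel hn Φ Ψ comm r _ _) f
  map_id _ := rfl
  map_comp := by rintro _ _ _ ⟨f⟩ ⟨g⟩; rfl

theorem UFun_lift : UFun P n ⋙ lift hn Φ Ψ comm = Φ := by
  refine CategoryTheory.Functor.hext ?_ ?_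
  · rintro ⟨s, ⟨x, hx⟩, ⟨y, hy⟩⟩
    exact congrArg Φ.obj (dec_mul P hn _ _ _ _ _ _)
  · rintro ⟨s, ⟨x, hx⟩, ⟨x', hx'⟩⟩ ⟨_, ⟨y, hy⟩, ⟨y', hy'⟩⟩ ⟨⟨f⟩, ⟨g⟩⟩
    exact liftWord_tensor hn Φ Ψ comm f g _ _ s hx hx'

theorem VFun_lift : VFun P n ⋙ lift hn Φ Ψ comm = Ψ := by
  have e : ends P n ⋙ VFun P n ⋙ lift hn Φ Ψ comm = ends P n ⋙ Ψ := by
    rw [← Functor.assoc, ← square_comm, Functor.assoc, UFun_lift, comm]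
  refine sigma_ext fun t => cyl_ext (fun b => ?_) ?_
  · exact congrArg (fun F => Prod.sectL _ (Discrete.mk b) ⋙ Sigma.incl (C := fun t : Triple P n =>
      (Obj P t.i × Obj P t.j × Obj P t.k) × Discrete Bool) t ⋙ F) e
  · rintro ⟨⟨x, hx⟩, ⟨y, hy⟩, ⟨z, hz⟩⟩
    change (lift hn Φ Ψ comm).map ((VFun P n).map
      (triHom t (𝟙 ⟨x, hx⟩) (𝟙 ⟨y, hy⟩) (𝟙 ⟨z, hz⟩) false true)) ≍ _
    rw [VFun_assoc]
    exact liftWord_assoc hn Φ Ψ comm x y z _ _ _ t hx hy hz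

end Lift

/-- For `n ≥ 2` the groupoid of associations of `n` letters is the pushout of the groupoids of
associations of fewer letters. -/
theorem isPushout (n : ℕ) (hn : 2 ≤ n) :
    IsPushout (WFun P n).toCatHom (ends P n).toCatHom (UFun P n).toCatHom (VFun P n).toCatHom where
  w := Cat.ext (square_comm P n)
  isColimit' := ⟨PushoutCocone.IsColimit.mk _
    (fun s => (lift hn s.inl.toFunctor s.inr.toFunctor
      (congrArg Cat.Hom.toFunctor s.condition)).toCatHom)
    (fun _ => Cat.ext (UFun_lift hn _ _ _))
    (fun _ => Cat.ext (VFun_lift hn _ _ _))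
    (fun _ _ h₁ h₂ => Cat.ext (hom_ext P hn
      ((congrArg Cat.Hom.toFunctor h₁).trans (UFun_lift hn _ _ _).symm)
      ((congrArg Cat.Hom.toFunctor h₂).trans (VFun_lift hn _ _ _).symm)))⟩

theorem Word.rel_id_of_length_one {P : ℕ → Prop} {x y : Tree} (f : Word P x y)
    (hx : x.length = 1) : ∃ h : x = y, WordRel P f (h ▸ Word.id x) := by
  induction f with
  | id x => exact ⟨rfl, .refl _⟩
  | comp f g ihf ihg =>
    obtain ⟨rfl, hf⟩ := ihf hx
    obtain ⟨rfl, hg⟩ := ihg hx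
    exact ⟨rfl, .trans (.comp hf hg) (.id_comp _)⟩
  | inv f ih =>
    obtain ⟨rfl, hf⟩ := ih (f.length_eq.trans hx)
    exact ⟨rfl, .trans (.symm (.comp_id _)) (.trans (.comp (.refl _) (.symm hf)) (.inv_comp _))⟩
  | @tensor x _ x' _ f g _ _ =>
    have := x.length_pos
    have := x'.length_pos
    exact absurd (show x.length + x'.length = 1 from hx) (by omega)
  | assoc x y z h =>
    have := x.length_pos
    have := y.length_pos
    exact absurd (show x.length + (y.length + z.length) = 1 from hx) (by omega)

/-- The groupoid of associations of one letter has one object. -/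
instance uniqueObjOne : Unique (Obj P 1) where
  default := ⟨.of (), rfl⟩
  uniq x := by
    obtain ⟨x, h⟩ := x
    rcases x with _ | ⟨x, y⟩
    · rfl
    · have := x.length_pos
      have := y.length_pos
      exact absurd (show x.length + y.length = 1 from h) (by omega)

/-- The groupoid of associations of one letter has only identity morphisms. -/
instance subsingletonHomOne (x y : Obj P 1) : Subsingleton (x ⟶ y) := by
  refine ⟨?_⟩
  rintro ⟨f⟩ ⟨g⟩
  obtain ⟨_, hf⟩ := f.rel_id_of_length_one x.len
  obtain ⟨_, hg⟩ := g.rel_id_of_length_one x.len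
  exact Quotient.sound (WordRel.trans hf (WordRel.symm hg))

/-! ### The Catalan groupoids, their maximal indiscrete subgroupoids and the fundamental groups -/

/-- All basic reassociations. -/
def all : ℕ → Prop := fun _ => True

/-- The basic reassociations that move one letter. -/
def one : ℕ → Prop := fun m => m = 1

/-- The Catalan groupoid `A_n`. -/
abbrev A (n : ℕ) : Type := Obj all n

/-- The groupoid `T_n`. -/
abbrev T (n : ℕ) : Type := Obj one n

/-- The functor `L_n : T_n ⥤ A_n`, which is the identity on associations and sends each basic
reassociation to itself. -/
def L (n : ℕ) : T n ⥤ A n where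
  obj x := ⟨x.tree, x.len⟩
  map f := RHom.mono (fun _ _ => trivial) f
  map_id _ := rfl
  map_comp := by rintro _ _ _ ⟨f⟩ ⟨g⟩; rfl

/-- `L` is compatible with the right vertical functors of the pushout squares. -/
theorem U_L (a b n : ℕ) (h : a + b = n) :
    U one a b n h ⋙ L n = (L a).prod (L b) ⋙ U all a b n h := by
  refine CategoryTheory.Functor.hext (fun _ => rfl) ?_
  rintro _ _ ⟨⟨f⟩, ⟨g⟩⟩
  rfl

/-- `L` is compatible with the lower horizontal functors of the pushout squares. -/
theorem V_L (n : ℕ) (t : Triple one n) :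
    VComp one n t ⋙ L n = ((L t.i).prod ((L t.j).prod (L t.k))).prod (𝟭 (Codiscrete Bool)) ⋙
      VComp all n ⟨t.i, t.j, t.k, t.hi, t.hj, t.hk, trivial, t.sum⟩ := by
  refine cyl_ext (fun b => ?_) (fun x => HEq.rfl)
  rcases b with _ | _
  all_goals
    refine CategoryTheory.Functor.hext (fun _ => rfl) ?_
    rintro _ _ ⟨⟨f⟩, ⟨g⟩, ⟨h⟩⟩
    rfl

/-- `T_n` collapsed to a point. -/
def collapse (n : ℕ) : T n ⥤ Discrete PUnit := (Functor.const (T n)).obj ⟨PUnit.unit⟩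

/-- The fundamental group `π(A_n, T_n)`, as a category: the pushout of `A_n ← T_n → 1`. -/
noncomputable def fundamental (n : ℕ) : Cat.{0, 0} := pushout (L n).toCatHom (collapse n).toCatHom

/-- The canonical functor `A_n ⥤ π(A_n, T_n)`. -/
noncomputable def proj (n : ℕ) : A n ⥤ fundamental n :=
  (pushout.inl (L n).toCatHom (collapse n).toCatHom).toFunctor

/-- A group as a category with one object, whose composition in diagrammatic order is the
multiplication of the group. -/
abbrev deloop (G : Type) [Group G] : Cat.{0, 0} := Cat.of (SingleObj Gᵐᵒᵖ)

/-- The element of the group given by a morphism. -/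
def deloop.elem {G : Type} [Group G] {x y : deloop G} (f : x ⟶ y) : G :=
  MulOpposite.unop (show Gᵐᵒᵖ from f)

/-! ### The presentation -/

/-- The letters `λ` and `ρ`. -/
inductive Letter
  | lam
  | rho

/-- The symbols `X<i,j,k>` with `X` in the free monoid on `λ` and `ρ`. -/
structure Gen where
  word : FreeMonoid Letter
  i : ℕ
  j : ℕ
  k : ℕ

/-- `λ` in the free monoid. -/
def lam : FreeMonoid Letter := FreeMonoid.of Letter.lam

/-- `ρ` in the free monoid. -/
def rho : FreeMonoid Letter := FreeMonoid.of Letter.rho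

/-- `X Y<i,j,k>`. -/
def Gen.pre (X : FreeMonoid Letter) (g : Gen) : Gen := ⟨X * g.word, g.i, g.j, g.k⟩

/-- The symbol `<i,j,k>`. -/
def br (i j k : ℕ) : Gen := ⟨1, i, j, k⟩

/-- The sets `G_n` of generators. -/
inductive IsGen : ℕ → Gen → Prop
  | lam (i m : ℕ) (hi : 0 < i) (y : Gen) : IsGen m y → IsGen (i + m) (y.pre (lam ^ i))
  | rho (i m : ℕ) (hm : 0 < m) (x : Gen) : IsGen i x → IsGen (i + m) (x.pre (rho ^ m))
  | br (i j k : ℕ) (hi : 0 < i) (hj : 0 < j) (hk : 0 < k) : IsGen (i + j + k) (br i j k)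

/-- The generator of the free group on all symbols. -/
abbrev fr (g : Gen) : FreeGroup Gen := FreeGroup.of g

/-- The sets `R_n` of relators; the relation `u = v` is the relator `u * v⁻¹`. -/
inductive IsRel : ℕ → FreeGroup Gen → Prop
  | left (i j k : ℕ) (hi : 0 < i) (hj : 0 < j) (hk : 0 < k) (x : Gen) (hx : IsGen i x) :
      IsRel (i + j + k) (fr (br i j k) * fr (x.pre (rho ^ k * rho ^ j)) * (fr (br i j k))⁻¹ *
        (fr (x.pre (rho ^ (j + k))))⁻¹)
  | middle (i j k : ℕ) (hi : 0 < i) (hj : 0 < j) (hk : 0 < k) (y : Gen) (hy : IsGen j y) :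
      IsRel (i + j + k) (fr (br i j k) * fr (y.pre (rho ^ k * lam ^ i)) * (fr (br i j k))⁻¹ *
        (fr (y.pre (lam ^ i * rho ^ k)))⁻¹)
  | right (i j k : ℕ) (hi : 0 < i) (hj : 0 < j) (hk : 0 < k) (z : Gen) (hz : IsGen k z) :
      IsRel (i + j + k) (fr (br i j k) * fr (z.pre (lam ^ (i + j))) * (fr (br i j k))⁻¹ *
        (fr (z.pre (lam ^ i * lam ^ j)))⁻¹)
  | mis (i k : ℕ) (hi : 0 < i) (hk : 0 < k) : IsRel (i + 1 + k) (fr (br i 1 k))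
  | lam (i m : ℕ) (hi : 0 < i) (r : FreeGroup Gen) :
      IsRel m r → IsRel (i + m) (FreeGroup.map (Gen.pre (lam ^ i)) r)
  | rho (i m : ℕ) (hm : 0 < m) (r : FreeGroup Gen) :
      IsRel i r → IsRel (i + m) (FreeGroup.map (Gen.pre (rho ^ m)) r)
  | comm (i m : ℕ) (x y : Gen) (hx : IsGen i x) (hy : IsGen m y) :
      IsRel (i + m) (fr (x.pre (rho ^ m)) * fr (y.pre (lam ^ i)) *
        (fr (y.pre (lam ^ i)) * fr (x.pre (rho ^ m)))⁻¹)

/-- The generators `G_n`. -/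
abbrev G (n : ℕ) : Type := {g : Gen // IsGen n g}

/-- The relators `R_n`, as elements of the free group on `G_n`. -/
def R (n : ℕ) : Set (FreeGroup (G n)) := {r | IsRel n (FreeGroup.map Subtype.val r)}

/-- The edges of the class `X<i,j,k>`: `<i,j,k>` is the class of the basic reassociations
`f ⊗ (g ⊗ h) ⟶ (f ⊗ g) ⊗ h` of associations `f`, `g`, `h` of `i`, `j`, `k` letters, a prefix `λ ^ a`
stands for tensoring on the left with the identity of an association of `a` letters, and a prefix
`ρ ^ b` stands for tensoring on the right with the identity of an association of `b` letters. -/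
inductive IsEdge : Gen → ∀ {x y : Tree}, RHom all x y → Prop
  | br (f g h : Tree) : IsEdge (br f.length g.length h.length) (RHom.assoc f g h trivial)
  | lam (t : Tree) {x y : Tree} (X : Gen) (e : RHom all x y) :
      IsEdge X e → IsEdge (X.pre (lam ^ t.length)) (RHom.tensor (RHom.id t) e)
  | rho (t : Tree) {x y : Tree} (X : Gen) (e : RHom all x y) :
      IsEdge X e → IsEdge (X.pre (rho ^ t.length)) (RHom.tensor e (RHom.id t))

end Catalan

namespace Catalan

/-! ### The presented groups and their operators -/

/-! The plan is to show that the one-object category of `Pres n` has the universal property of the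
pushout of `A_n ← T_n → 1`, rather than to compute that pushout.

One half is a functor from `A_n` to `Pres n`. A formal reassociation gets a class by recursion: a
bracket goes to its generator, and `f ⊗ g = (f ⊗ 1)(1 ⊗ g)` goes to the `ρ`-prefixed class of `f`
times the `λ`-prefixed class of `g`. The relations of kind 3 make the prefixes homomorphisms between
the presented groups. Those of kind 4 give functoriality of the tensor product, and those of kind 1
give naturality of the brackets, so the class respects the defining congruence (`wordVal_rel`).
Those of kind 2 make it trivial on `T_n` (`wordVal_mono`).

The other half concerns a functor on `A_n` that is constant on `T_n`. It sends all objects to one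
object `c` and amounts to a homomorphism `Rep` to the opposite of `Aut c`. Since `T_n` is connected
(`connected`), naturality squares along `T_n` show that any two edges of one class differ by
morphisms of `T_n` (`IsEdge.conj_edge`). The homomorphism therefore has one value per symbol. These
values satisfy all relators, because each relator expresses a naturality square, an interchange law,
an element of `T_n` or a prefixed relator (`Rep.lift_gen_eq_one`). The induced map on `Pres n`
recovers the given functor (`Rep.hom_wordVal`). It is unique because each generator is the class of
an edge (`deloop_ext`).

For `n ≤ 6`, counting letters shows that once the symbols `X<i,1,k>` are killed, the only remaining
relation conjugates `ρλ<1,2,1>` into `λρ<1,2,1>` by `<1,4,1>`, for `n = 6` (`lift_eq_one`). It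
eliminates one generator. The group is thus free on the other symbols with `j ≥ 2`, which number 0,
1, 5 and 15 for `n` = 3, 4, 5 and 6. -/

/-- The group presented by the generators `G_n` and the relators `R_n`. -/
abbrev Pres (n : ℕ) : Type := PresentedGroup (R n)

theorem Gen.pre_pre (X Y : FreeMonoid Letter) (g : Gen) : (g.pre Y).pre X = g.pre (X * Y) := by
  simp only [Gen.pre, mul_assoc]

/-- The generator `λ ^ i y` of `G_n` for a generator `y` of `G_m`. -/
def lamGen {i m n : ℕ} (hi : 0 < i) (h : i + m = n) (y : G m) : G n :=
  ⟨y.1.pre (lam ^ i), h ▸ IsGen.lam i m hi y.1 y.2⟩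

/-- The generator `ρ ^ m x` of `G_n` for a generator `x` of `G_i`. -/
def rhoGen {i m n : ℕ} (hm : 0 < m) (h : i + m = n) (x : G i) : G n :=
  ⟨x.1.pre (rho ^ m), h ▸ IsGen.rho i m hm x.1 x.2⟩

/-- The generator `<i,j,k>` of `G_n`. -/
def brGen {i j k n : ℕ} (hi : 0 < i) (hj : 0 < j) (hk : 0 < k) (h : i + j + k = n) : G n :=
  ⟨br i j k, h ▸ IsGen.br i j k hi hj hk⟩

theorem mk_eq_one {n : ℕ} {r : FreeGroup (G n)} (h : IsRel n (FreeGroup.map Subtype.val r)) :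
    PresentedGroup.mk (R n) r = 1 :=
  PresentedGroup.one_of_mem h

/-- This is what lets a prefix descend to the presented groups. Relators are recognized after
forgetting that their letters lie in `G_n`, so it suffices that prefixing all symbols by `X`
preserves relators. -/
theorem mk_map_eq_one {m n : ℕ} (f : G m → G n) (X : FreeMonoid Letter)
    (hf : ∀ g, (f g).1 = g.1.pre X)
    (hR : ∀ r, IsRel m r → IsRel n (FreeGroup.map (Gen.pre X) r)) (r : FreeGroup (G m))
    (hr : r ∈ R m) : FreeGroup.lift (fun g => (PresentedGroup.of (f g) : Pres n)) r = 1 := by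
  have e : FreeGroup.lift (fun g => (PresentedGroup.of (f g) : Pres n)) =
      (PresentedGroup.mk (R n)).comp (FreeGroup.map f) :=
    FreeGroup.ext_hom _ _ fun g => by simp [PresentedGroup.of]
  rw [e]
  refine mk_eq_one ?_
  rw [FreeGroup.map.comp]
  have e' : Subtype.val ∘ f = Gen.pre X ∘ Subtype.val := funext hf
  rw [e', ← FreeGroup.map.comp]
  exact hR _ hr

/-- The homomorphism of presented groups given by the prefix `λ ^ i`. -/
def lamHom {i m n : ℕ} (hi : 0 < i) (h : i + m = n) : Pres m →* Pres n :=
  PresentedGroup.toGroup (mk_map_eq_one (lamGen hi h) (lam ^ i) (fun _ => rfl)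
    (fun r hr => h ▸ IsRel.lam i m hi r hr))

/-- The homomorphism of presented groups given by the prefix `ρ ^ m`. -/
def rhoHom {i m n : ℕ} (hm : 0 < m) (h : i + m = n) : Pres i →* Pres n :=
  PresentedGroup.toGroup (mk_map_eq_one (rhoGen hm h) (rho ^ m) (fun _ => rfl)
    (fun r hr => h ▸ IsRel.rho i m hm r hr))

theorem lamHom_of {i m n : ℕ} (hi : 0 < i) (h : i + m = n) (y : G m) :
    lamHom hi h (PresentedGroup.of y) = PresentedGroup.of (lamGen hi h y) :=
  PresentedGroup.toGroup.of _

theorem rhoHom_of {i m n : ℕ} (hm : 0 < m) (h : i + m = n) (x : G i) :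
    rhoHom hm h (PresentedGroup.of x) = PresentedGroup.of (rhoGen hm h x) :=
  PresentedGroup.toGroup.of _

/-- Two homomorphisms that are intertwined by `c` on the generators are intertwined by `c`. -/
theorem semiconj_of_gen {m : ℕ} {H : Type*} [Group H] (c : H) (φ ψ : Pres m →* H)
    (h : ∀ g : G m, c * φ (.of g) = ψ (.of g) * c) (a : Pres m) : c * φ a = ψ a * c := by
  have e : (MulAut.conj c).toMonoidHom.comp φ = ψ :=
    -- On generators, `φ` followed by conjugation by `c` is `ψ`; two homomorphisms that agree on
    -- generators are equal.
    PresentedGroup.ext fun g => by simp [h g]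
  rw [← e]
  simp

/-- The relations of kind 4 give this for generators; it extends to all elements one argument at a
time. -/
theorem rhoHom_comm_lamHom {i m n : ℕ} (hi : 0 < i) (hm : 0 < m) (h : i + m = n) (a : Pres i)
    (b : Pres m) : rhoHom hm h a * lamHom hi h b = lamHom hi h b * rhoHom hm h a := by
  refine semiconj_of_gen _ _ _ (fun y => ?_) b
  refine (semiconj_of_gen _ _ _ (fun x => ?_) a).symm
  rw [lamHom_of, rhoHom_of]
  refine (eq_of_mul_inv_eq_one ?_).symm
  subst h
  exact mk_eq_one (r := FreeGroup.of (rhoGen hm rfl x) * FreeGroup.of (lamGen hi rfl y) *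
    (FreeGroup.of (lamGen hi rfl y) * FreeGroup.of (rhoGen hm rfl x))⁻¹)
    (by simpa [rhoGen, lamGen] using IsRel.comm i m x.1 y.1 x.2 y.2)

/-! ### Naturality of the brackets in the presented groups -/

section Naturality

variable {i j k n : ℕ} (hi : 0 < i) (hj : 0 < j) (hk : 0 < k)

/-- The relations of kind 1 say that a bracket intertwines two composites of prefixes on generators.
This lemma and the next two pass from generators to arbitrary elements, which the classes of general
reassociations require. -/
theorem br_mul_left (h : i + j + k = n) (a : Pres i) :
    PresentedGroup.of (brGen hi hj hk h) * rhoHom hk h (rhoHom (n := i + j) hj rfl a) =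
      rhoHom (n := n) (m := j + k) (by omega) (by omega) a * PresentedGroup.of (brGen hi hj hk h) := by
  refine semiconj_of_gen _ ((rhoHom hk h).comp (rhoHom (n := i + j) hj rfl)) _ (fun x => ?_) a
  rw [MonoidHom.comp_apply, rhoHom_of, rhoHom_of, rhoHom_of]
  subst h
  refine mul_inv_eq_iff_eq_mul.1 (eq_of_mul_inv_eq_one ?_)
  refine mk_eq_one (r := FreeGroup.of _ * FreeGroup.of _ * (FreeGroup.of _)⁻¹ *
    (FreeGroup.of _)⁻¹) ?_
  simpa [rhoGen, brGen, Gen.pre_pre] using IsRel.left i j k hi hj hk x.1 x.2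

theorem br_mul_middle (h : i + j + k = n) (a : Pres j) :
    PresentedGroup.of (brGen hi hj hk h) * rhoHom hk h (lamHom (n := i + j) hi rfl a) =
      lamHom (n := n) (m := j + k) hi (by omega) (rhoHom hk rfl a) *
        PresentedGroup.of (brGen hi hj hk h) := by
  refine semiconj_of_gen _ ((rhoHom hk h).comp (lamHom (n := i + j) hi rfl))
    ((lamHom (n := n) (m := j + k) hi (by omega)).comp (rhoHom hk rfl)) (fun x => ?_) a
  rw [MonoidHom.comp_apply, MonoidHom.comp_apply, rhoHom_of, lamHom_of, lamHom_of,
    rhoHom_of]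
  subst h
  refine mul_inv_eq_iff_eq_mul.1 (eq_of_mul_inv_eq_one ?_)
  refine mk_eq_one (r := FreeGroup.of _ * FreeGroup.of _ * (FreeGroup.of _)⁻¹ *
    (FreeGroup.of _)⁻¹) ?_
  simpa [rhoGen, lamGen, brGen, Gen.pre_pre] using IsRel.middle i j k hi hj hk x.1 x.2

theorem br_mul_right (h : i + j + k = n) (a : Pres k) :
    PresentedGroup.of (brGen hi hj hk h) * lamHom (i := i + j) (n := n) (by omega) h a =
      lamHom (n := n) (m := j + k) hi (by omega) (lamHom hj rfl a) *
        PresentedGroup.of (brGen hi hj hk h) := by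
  refine semiconj_of_gen _ _
    ((lamHom (n := n) (m := j + k) hi (by omega)).comp (lamHom hj rfl)) (fun x => ?_) a
  rw [MonoidHom.comp_apply, lamHom_of, lamHom_of, lamHom_of]
  subst h
  refine mul_inv_eq_iff_eq_mul.1 (eq_of_mul_inv_eq_one ?_)
  refine mk_eq_one (r := FreeGroup.of _ * FreeGroup.of _ * (FreeGroup.of _)⁻¹ *
    (FreeGroup.of _)⁻¹) ?_
  simpa [lamGen, brGen, Gen.pre_pre] using IsRel.right i j k hi hj hk x.1 x.2

end Naturality

/-! ### The class of a reassociation in the presented group -/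

/-- The class of a formal reassociation of associations of `n` letters. -/
def wordVal : ∀ {x y : Tree} (_ : Word all x y) {n : ℕ} (_ : x.length = n), Pres n
  | _, _, .id _, _, _ => 1
  | _, _, .comp f g, _, h => wordVal f h * wordVal g (f.length_eq.symm.trans h)
  | _, _, .inv f, _, h => (wordVal f (f.length_eq.trans h))⁻¹
  -- The factorization `(f ⊗ 1)(1 ⊗ g)` is used; the other order gives the same element by
  -- `rhoHom_comm_lamHom`.
  | _, _, .tensor (x := x) (x' := x') f g, _, h =>
    rhoHom x'.length_pos h (wordVal f rfl) * lamHom x.length_pos h (wordVal g rfl)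
  | _, _, .assoc x y z _, _, h =>
    .of (brGen x.length_pos y.length_pos z.length_pos ((Nat.add_assoc _ _ _).trans h))

/-- The lengths `a` and `b` are variables so that the classes of the factors can live in groups
indexed by the lengths of other associations, which a reassociation makes only propositionally
equal. The same purpose shapes `wordVal_assoc`. -/
theorem wordVal_tensor {x y x' y' : Tree} (f : Word all x y) (g : Word all x' y') {n a b : ℕ}
    (h : (x * x').length = n) (ha : x.length = a) (hb : x'.length = b) :
    wordVal (f.tensor g) h =
      rhoHom (hb ▸ x'.length_pos) (ha ▸ hb ▸ h) (wordVal f ha) *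
        lamHom (ha ▸ x.length_pos) (ha ▸ hb ▸ h) (wordVal g hb) := by
  subst ha hb
  rfl

theorem wordVal_assoc {x y z : Tree} (hy : all y.length) {n a b c : ℕ}
    (h : (x * (y * z)).length = n) (ha : x.length = a) (hb : y.length = b) (hc : z.length = c) :
    wordVal (.assoc x y z hy) h = .of (brGen (ha ▸ x.length_pos) (hb ▸ y.length_pos)
      (hc ▸ z.length_pos) (ha ▸ hb ▸ hc ▸ (Nat.add_assoc _ _ _).trans h)) := by
  subst ha hb hc
  rfl

theorem mul_mul_mul_comm_of_comm {H : Type*} [Group H] {a b c d : H} (h : b * c = c * b) :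
    a * b * (c * d) = a * c * (b * d) := by
  rw [mul_assoc, ← mul_assoc b, h, mul_assoc, mul_assoc]

theorem intertwine {H : Type*} [Group H] {t a b c a' b' c' : H} (ha : t * a = a' * t)
    (hb : t * b = b' * t) (hc : t * c = c' * t) : a' * (b' * c') * t = t * (a * b * c) := by
  rw [mul_assoc, mul_assoc, ← hc, ← mul_assoc b', ← hb, ← mul_assoc, ← mul_assoc, ← ha]
  simp only [mul_assoc]

/-- Only two cases use relations directly: functoriality of the tensor product, where the middle
factors are exchanged by commutation, and naturality, where the bracket is carried past the three
factors in turn. -/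
theorem wordVal_rel {x y : Tree} {f g : Word all x y} (r : WordRel all f g) :
    ∀ {n : ℕ} (h : x.length = n), wordVal f h = wordVal g h := by
  induction r with
  | refl f => intros; rfl
  | symm _ ih => intro n h; exact (ih h).symm
  | trans _ _ ih ih' => intro n h; exact (ih h).trans (ih' h)
  | comp _ _ ih ih' =>
    intro n h
    simp only [wordVal]
    rw [ih, ih']
  | inv _ ih =>
    intro n h
    simp only [wordVal]
    rw [ih]
  | tensor _ _ ih ih' =>
    intro n h
    simp only [wordVal]
    rw [ih, ih']
  | id_comp f => intros; simp only [wordVal, one_mul]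
  | comp_id f => intros; simp only [wordVal, mul_one]
  | comp_assoc f g h => intros; simp only [wordVal, mul_assoc]
  | inv_comp f => intros; simp only [wordVal, inv_mul_cancel]
  | comp_inv f => intros; simp only [wordVal, mul_inv_cancel]
  | tensor_id x y => intros; simp only [wordVal, map_one, one_mul]
  | @tensor_comp x y z x' y' z' f g f' g' =>
    intro n h
    have e : (y * y').length = n := (f.tensor f').length_eq.symm.trans h
    have e₁ : wordVal ((f.comp g).tensor (f'.comp g')) h =
        rhoHom x'.length_pos h (wordVal f rfl * wordVal g f.length_eq.symm) *
          lamHom x.length_pos h (wordVal f' rfl * wordVal g' f'.length_eq.symm) := rfl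
    have e₂ := wordVal_tensor g g' e f.length_eq.symm f'.length_eq.symm
    rw [map_mul, map_mul] at e₁
    exact e₁.trans ((mul_mul_mul_comm_of_comm (rhoHom_comm_lamHom _ _ _ _ _)).trans
      (congrArg (wordVal (f.tensor f') h * ·) e₂.symm))
  | @naturality x y z x' y' z' f g h hy hy' =>
    intro n hn
    have e : x.length + y.length + z.length = n := (Nat.add_assoc _ _ _).trans hn
    have hn' : x.length + (y.length + z.length) = n := hn
    have e' : (x' * (y' * z')).length = n := (f.tensor (g.tensor h)).length_eq.symm.trans hn
    -- Reassociations preserve lengths, so the brackets on both sides of the square have the same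
    -- class.
    have e₀ := wordVal_assoc hy' e' f.length_eq.symm g.length_eq.symm h.length_eq.symm
    have e₁ := br_mul_left x.length_pos y.length_pos z.length_pos e (wordVal f rfl)
    have e₂ := br_mul_middle x.length_pos y.length_pos z.length_pos e (wordVal g rfl)
    have e₃ := br_mul_right x.length_pos y.length_pos z.length_pos e (wordVal h rfl)
    have l : wordVal (f.tensor (g.tensor h)) hn =
        rhoHom (Nat.add_pos_left y.length_pos z.length) hn' (wordVal f rfl) *
          lamHom x.length_pos hn' (rhoHom (m := z.length) z.length_pos rfl (wordVal g rfl) *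
            lamHom y.length_pos rfl (wordVal h rfl)) := rfl
    have r : wordVal ((f.tensor g).tensor h) e =
        rhoHom z.length_pos e (rhoHom y.length_pos rfl (wordVal f rfl) *
          lamHom x.length_pos rfl (wordVal g rfl)) *
          lamHom (Nat.add_pos_left x.length_pos y.length) e (wordVal h rfl) := rfl
    rw [map_mul] at l r
    change wordVal (f.tensor (g.tensor h)) hn * wordVal (.assoc x' y' z' hy') e' =
      .of (brGen x.length_pos y.length_pos z.length_pos e) * wordVal ((f.tensor g).tensor h) e
    rw [e₀, l, r]
    exact intertwine e₁ e₂ e₃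

/-- The relations `<i,1,k> = e` kill the brackets of `T_n`, and prefixes are homomorphisms, so
everything generated by these brackets dies. -/
theorem wordVal_mono {x y : Tree} (f : Word one x y) :
    ∀ {n : ℕ} (h : x.length = n), wordVal (f.mono (Q := all) fun _ _ => trivial) h = 1 := by
  induction f with
  | id x => intros; rfl
  | comp f g ihf ihg => intro n h; exact (congrArg₂ (· * ·) (ihf _) (ihg _)).trans (one_mul 1)
  | inv f ih => intro n h; exact (congrArg (·⁻¹) (ih _)).trans inv_one
  | tensor f g ihf ihg =>
    intro n h
    refine (congrArg₂ (· * ·) (congrArg _ (ihf _)) (congrArg _ (ihg _))).trans ?_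
    rw [map_one, map_one, one_mul]
  | assoc x y z h =>
    intro n hn
    refine (wordVal_assoc trivial hn rfl h rfl).trans ?_
    refine mk_eq_one (r := FreeGroup.of _) ?_
    have e : x.length + 1 + z.length = n := by
      rw [← hn, ← h]; exact Nat.add_assoc _ _ _
    subst e
    simpa [brGen] using IsRel.mis x.length z.length x.length_pos z.length_pos

theorem RHom.length_eq {P : ℕ → Prop} {x y : Tree} (f : RHom P x y) : x.length = y.length := by
  obtain ⟨f⟩ := f
  exact f.length_eq

/-- The class of a reassociation of associations of `n` letters. -/
def homVal {x y : Tree} (f : RHom all x y) {n : ℕ} (h : x.length = n) : Pres n :=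
  Quotient.lift (fun w : Word all x y => wordVal w h) (fun _ _ r => wordVal_rel r h) f

/-- The functor that sends every reassociation to its class in the presented group. -/
def classFunctor (n : ℕ) : A n ⥤ deloop (Pres n) where
  obj _ := SingleObj.star (Pres n)ᵐᵒᵖ
  map {x _} f := MulOpposite.op (homVal f x.len)
  map_id _ := rfl
  map_comp := by rintro _ _ _ ⟨f⟩ ⟨g⟩; rfl

theorem L_classFunctor (n : ℕ) : L n ⋙ classFunctor n =
    collapse n ⋙ (Functor.const (Discrete PUnit.{1})).obj (SingleObj.star (Pres n)ᵐᵒᵖ) := by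
  refine CategoryTheory.Functor.hext (fun _ => rfl) ?_
  rintro x y ⟨f⟩
  exact heq_of_eq (congrArg (MulOpposite.op (α := Pres n)) (wordVal_mono f x.len))

theorem IsEdge.isGen {X : Gen} {x y : Tree} {f : RHom all x y} (hf : IsEdge X f) :
    IsGen x.length X := by
  induction hf with
  | br f g h =>
    have := IsGen.br f.length g.length h.length f.length_pos g.length_pos h.length_pos
    rwa [Nat.add_assoc] at this
  | lam t X e _ ih => exact IsGen.lam _ _ t.length_pos X ih
  | rho t X e _ ih => exact IsGen.rho _ _ t.length_pos X ih

theorem homVal_of_isEdge {X : Gen} {x y : Tree} {f : RHom all x y} (hf : IsEdge X f) :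
    ∀ {n : ℕ} (h : x.length = n) (hX : IsGen n X),
      homVal f h = (PresentedGroup.of ⟨X, hX⟩ : Pres n) := by
  induction hf with
  | br f g h => intros; rfl
  | @lam t x y X e he ih =>
    intro n h hX
    obtain ⟨e⟩ := e
    have h' : t.length + x.length = n := h
    have e₁ : homVal (RHom.tensor (RHom.id t) (Quot.mk _ e)) h =
      rhoHom x.length_pos h' 1 * lamHom t.length_pos h' (homVal (Quot.mk _ e) rfl) := rfl
    rw [e₁, map_one, one_mul, ih rfl he.isGen, lamHom_of]
    rfl
  | @rho t x y X e he ih =>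
    intro n h hX
    obtain ⟨e⟩ := e
    have h' : x.length + t.length = n := h
    have e₁ : homVal (RHom.tensor (Quot.mk _ e) (RHom.id t)) h =
      rhoHom t.length_pos h' (homVal (Quot.mk _ e) rfl) * lamHom x.length_pos h' 1 := rfl
    rw [e₁, map_one, mul_one, ih rfl he.isGen, rhoHom_of]
    rfl

/-! ### Equations between reassociations -/

namespace RHom

variable {P : ℕ → Prop}

theorem id_comp {x y : Tree} (f : RHom P x y) : (id x).comp f = f := by
  obtain ⟨f⟩ := f
  exact Quotient.sound (.id_comp f)

theorem comp_id {x y : Tree} (f : RHom P x y) : f.comp (id y) = f := by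
  obtain ⟨f⟩ := f
  exact Quotient.sound (.comp_id f)

theorem comp_assoc {x y z w : Tree} (f : RHom P x y) (g : RHom P y z) (h : RHom P z w) :
    (f.comp g).comp h = f.comp (g.comp h) := by
  obtain ⟨f⟩ := f
  obtain ⟨g⟩ := g
  obtain ⟨h⟩ := h
  exact Quotient.sound (.comp_assoc f g h)

theorem inv_comp {x y : Tree} (f : RHom P x y) : f.inv.comp f = id y := by
  obtain ⟨f⟩ := f
  exact Quotient.sound (.inv_comp f)

theorem tensor_id (x y : Tree) : (id x : RHom P x x).tensor (id y) = id (x * y) :=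
  Quotient.sound (.tensor_id x y)

theorem tensor_comp {x y z x' y' z' : Tree} (f : RHom P x y) (g : RHom P y z) (f' : RHom P x' y')
    (g' : RHom P y' z') :
    (f.comp g).tensor (f'.comp g') = (f.tensor f').comp (g.tensor g') := by
  obtain ⟨f⟩ := f
  obtain ⟨g⟩ := g
  obtain ⟨f'⟩ := f'
  obtain ⟨g'⟩ := g'
  exact Quotient.sound (.tensor_comp f g f' g')

theorem naturality {x y z x' y' z' : Tree} (f : RHom P x x') (g : RHom P y y') (h : RHom P z z')
    (hy : P y.length) (hy' : P y'.length) :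
    (f.tensor (g.tensor h)).comp (assoc x' y' z' hy') =
      (assoc x y z hy).comp ((f.tensor g).tensor h) := by
  obtain ⟨f⟩ := f
  obtain ⟨g⟩ := g
  obtain ⟨h⟩ := h
  exact Quotient.sound (.naturality f g h hy hy')

theorem tensor_eq_left_right {x y x' y' : Tree} (f : RHom P x y) (g : RHom P x' y') :
    f.tensor g = (f.tensor (id x')).comp ((id y).tensor g) := by
  rw [← tensor_comp, id_comp, comp_id]

theorem tensor_eq_right_left {x y x' y' : Tree} (f : RHom P x y) (g : RHom P x' y') :
    f.tensor g = ((id x).tensor g).comp (f.tensor (id y')) := by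
  rw [← tensor_comp, id_comp, comp_id]

/-- The image in the Catalan groupoid of a reassociation that moves single letters. -/
abbrev incl {x y : Tree} (f : RHom one x y) : RHom all x y := f.mono fun _ _ => trivial

theorem incl_comp {x y z : Tree} (f : RHom one x y) (g : RHom one y z) :
    (f.comp g).incl = f.incl.comp g.incl := by
  obtain ⟨f⟩ := f
  obtain ⟨g⟩ := g
  rfl

theorem incl_tensor {x y x' y' : Tree} (f : RHom one x y) (g : RHom one x' y') :
    (f.tensor g).incl = f.incl.tensor g.incl := by
  obtain ⟨f⟩ := f
  obtain ⟨g⟩ := g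
  rfl

end RHom

/-! ### The groupoids `T_n` are connected -/

/-- The association of one letter. -/
abbrev leaf : Tree := .of ()

theorem eq_leaf {x : Tree} (h : x.length = 1) : x = leaf := by
  rcases x with _ | ⟨x, y⟩
  · rfl
  · have := x.length_pos
    have := y.length_pos
    exact absurd (show x.length + y.length = 1 from h) (by omega)

theorem length_mul (x y : Tree) : (x * y).length = x.length + y.length := rfl

theorem length_mul_left {t x : Tree} {m n : ℕ} (hx : x.length = m) (h : t.length + m = n) :
    (t * x).length = n := by
  rw [length_mul, hx, h]

theorem length_mul_right {t x : Tree} {m n : ℕ} (hx : x.length = m) (h : m + t.length = n) :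
    (x * t).length = n := by
  rw [length_mul, hx, h]

theorem length_leaf : leaf.length = 1 := rfl

/-- The association of `n` letters with all brackets to the left, for positive `n`. -/
def comb : ℕ → Tree
  | 0 => leaf
  | 1 => leaf
  | n + 2 => comb (n + 1) * leaf

theorem length_comb : ∀ {n : ℕ}, 0 < n → (comb n).length = n
  | 1, _ => rfl
  | n + 2, _ => by rw [comb, length_mul, length_comb n.succ_pos, length_leaf]

theorem nonempty_comb (n : ℕ) :
    ∀ x : Tree, x.length = n → Nonempty (RHom one x (comb n)) := by
  induction n using Nat.strong_induction_on with
  | _ n ih =>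
    have conn : ∀ x y : Tree, x.length = y.length → x.length < n → Nonempty (RHom one x y) := by
      intro x y h hx
      obtain ⟨f⟩ := ih _ hx x rfl
      obtain ⟨g⟩ := ih _ hx y h.symm
      exact ⟨f.comp g.inv⟩
    -- Letters are moved one by one from the right factor to the left one. The outer induction
    -- brings `y` to the form `leaf * comb m`; a bracket with middle factor `leaf` then leaves a
    -- right factor of `m` letters.
    have step : ∀ m, ∀ x y : Tree, y.length = m → x.length + m = n →
        Nonempty (RHom one (x * y) (comb n)) := by
      intro m
      induction m with
      | zero => intro x y hy; exact absurd hy y.length_pos.ne'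
      | succ m ihm =>
        intro x y hy hx
        have := x.length_pos
        rcases Nat.eq_zero_or_pos m with rfl | hm
        · obtain rfl := eq_leaf hy
          -- Writing `n` as `k + 2` makes `comb n` unfold to `comb (k + 1) * leaf`.
          obtain ⟨k, rfl⟩ : ∃ k, n = k + 2 := ⟨n - 2, by omega⟩
          obtain ⟨f⟩ := ih (k + 1) (by omega) x (by omega)
          exact ⟨f.tensor (RHom.id leaf)⟩
        · have hc : (comb m).length = m := length_comb hm
          obtain ⟨f⟩ := conn y (leaf * comb m) (by rw [length_mul, length_leaf]; omega) (by omega)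
          obtain ⟨g⟩ := ihm (x * leaf) (comb m) hc (by rw [length_mul, length_leaf]; omega)
          exact ⟨(((RHom.id x).tensor f).comp (RHom.assoc x leaf (comb m) rfl)).comp g⟩
    intro x hx
    rcases x with _ | ⟨x, y⟩
    · obtain rfl : 1 = n := hx
      exact ⟨RHom.id _⟩
    · exact step _ x y rfl hx

/-- Any two associations of the same number of letters are connected by moving single letters. -/
theorem connected {x y : Tree} (h : x.length = y.length) : Nonempty (RHom one x y) := by
  obtain ⟨f⟩ := nonempty_comb _ x rfl
  obtain ⟨g⟩ := nonempty_comb _ y h.symm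
  exact ⟨f.comp g.inv⟩

/-! ### Edges of the same class are conjugate -/

/-- Two reassociations are conjugate if they differ by reassociations moving single letters. -/
def Conj {x y x' y' : Tree} (e : RHom all x y) (e' : RHom all x' y') : Prop :=
  ∃ (s : RHom one x x') (t : RHom one y y'), e.comp t.incl = s.incl.comp e'

theorem Conj.trans {x y x' y' x'' y'' : Tree} {e : RHom all x y} {e' : RHom all x' y'}
    {e'' : RHom all x'' y''} (h : Conj e e') (h' : Conj e' e'') : Conj e e'' := by
  obtain ⟨s, t, h⟩ := h
  obtain ⟨s', t', h'⟩ := h'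
  refine ⟨s.comp s', t.comp t', ?_⟩
  rw [RHom.incl_comp, RHom.incl_comp, ← RHom.comp_assoc, h, RHom.comp_assoc, h', RHom.comp_assoc]

theorem Conj.symm {x y x' y' : Tree} {e : RHom all x y} {e' : RHom all x' y'}
    (h : Conj e e') : Conj e' e := by
  obtain ⟨⟨s⟩, ⟨t⟩, h⟩ := h
  refine ⟨RHom.inv (RHom.mk s), RHom.inv (RHom.mk t), ?_⟩
  have h₁ : (RHom.inv (RHom.mk s)).incl.comp (RHom.mk s).incl = RHom.id _ :=
    RHom.inv_comp (RHom.mk s).incl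
  have h₂ : (RHom.mk t).incl.comp (RHom.inv (RHom.mk t)).incl = RHom.id _ :=
    Quotient.sound (.comp_inv _)
  have h' : e.comp (RHom.mk t).incl = (RHom.mk s).incl.comp e' := h
  rw [← RHom.id_comp e', ← h₁, RHom.comp_assoc (RHom.inv _).incl, ← h', RHom.comp_assoc,
    RHom.comp_assoc, h₂, RHom.comp_id]

theorem Conj.tensor {x y x' y' z w z' w' : Tree} {e : RHom all x y} {e' : RHom all x' y'}
    {f : RHom all z w} {f' : RHom all z' w'}
    (h : Conj e e') (h' : Conj f f') : Conj (e.tensor f) (e'.tensor f') := by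
  obtain ⟨s, t, h⟩ := h
  obtain ⟨s', t', h'⟩ := h'
  refine ⟨s.tensor s', t.tensor t', ?_⟩
  rw [RHom.incl_tensor, RHom.incl_tensor, ← RHom.tensor_comp, ← RHom.tensor_comp, h, h']

theorem Conj.refl {x y : Tree} (e : RHom all x y) : Conj e e :=
  ⟨RHom.id x, RHom.id y, (RHom.comp_id e).trans (RHom.id_comp e).symm⟩

/-- Any morphism of `T_n` between `t` and `t'` serves on both sides; hence the choice of the
tensored identity does not matter up to conjugacy. -/
theorem Conj.id {t t' : Tree} (h : t.length = t'.length) : Conj (RHom.id t) (RHom.id t') := by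
  obtain ⟨s⟩ := connected h
  exact ⟨s, s, (RHom.id_comp _).trans (RHom.comp_id _).symm⟩

/-- This is the naturality square of the brackets along morphisms of `T_i`, `T_j` and `T_k`, which
exist by connectedness. -/
theorem Conj.assoc {x y z x' y' z' : Tree} (hx : x.length = x'.length) (hy : y.length = y'.length)
    (hz : z.length = z'.length) :
    Conj (RHom.assoc x y z trivial) (RHom.assoc x' y' z' trivial) := by
  obtain ⟨f⟩ := connected hx
  obtain ⟨g⟩ := connected hy
  obtain ⟨h⟩ := connected hz
  refine ⟨f.tensor (g.tensor h), (f.tensor g).tensor h, ?_⟩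
  simp only [RHom.incl_tensor]
  exact (RHom.naturality _ _ _ _ _).symm

/-- A bracket with a one-letter middle factor belongs to `T_n`, so its naturality square is itself a
conjugacy. -/
theorem Conj.tensor_leaf {x y z x' y' z' : Tree} (hy : y.length = 1) (hy' : y'.length = 1)
    (f : RHom all x x') (g : RHom all y y') (h : RHom all z z') :
    Conj (f.tensor (g.tensor h)) ((f.tensor g).tensor h) :=
  ⟨RHom.assoc x y z hy, RHom.assoc x' y' z' hy', RHom.naturality f g h trivial trivial⟩

/-- A chosen edge of the class `X<i,j,k>`. -/
def stdEdge (i j k : ℕ) : List Letter → Σ x y : Tree, RHom all x y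
  | [] => ⟨_, _, RHom.assoc (comb i) (comb j) (comb k) trivial⟩
  | .lam :: X => ⟨_, _, (RHom.id leaf).tensor (stdEdge i j k X).2.2⟩
  | .rho :: X => ⟨_, _, (stdEdge i j k X).2.2.tensor (RHom.id leaf)⟩

/-- A chosen edge of the class `g`. -/
def Gen.edge (g : Gen) : Σ x y : Tree, RHom all x y := stdEdge g.i g.j g.k g.word.toList

theorem Gen.pre_pow_succ (X : FreeMonoid Letter) (n : ℕ) (g : Gen) :
    (g.pre X).pre (X ^ n) = g.pre (X ^ (n + 1)) := by
  rw [Gen.pre_pre, pow_succ]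

/-- Tensoring with `t` reduces to tensoring with one letter at a time: replace `t` by `comb (n + 1)
* leaf`, shift the last leaf onto the edge, and absorb it into the symbol as a letter `λ`. The case
of `ρ` is the mirror image. -/
theorem conj_edge_lam (n : ℕ) : ∀ (t : Tree) (_ : t.length = n + 1) (g : Gen),
    Conj ((RHom.id t).tensor g.edge.2.2) (g.pre (lam ^ (n + 1))).edge.2.2 := by
  induction n with
  | zero =>
    intro t ht g
    obtain rfl := eq_leaf ht
    rw [pow_one]
    exact Conj.refl _
  | succ n ih =>
    intro t ht g
    have hc : (comb (n + 1)).length = n + 1 := length_comb n.succ_pos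
    refine ((Conj.id (t' := comb (n + 1) * leaf) ?_).tensor (Conj.refl _)).trans ?_
    · rw [ht, length_mul, hc, length_leaf]
    · rw [← RHom.tensor_id]
      refine (Conj.tensor_leaf rfl rfl _ _ _).symm.trans ?_
      rw [← Gen.pre_pow_succ]
      exact ih (comb (n + 1)) hc (g.pre lam)

theorem conj_edge_rho (n : ℕ) : ∀ (t : Tree) (_ : t.length = n + 1) (g : Gen),
    Conj (g.edge.2.2.tensor (RHom.id t)) (g.pre (rho ^ (n + 1))).edge.2.2 := by
  induction n with
  | zero =>
    intro t ht g
    obtain rfl := eq_leaf ht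
    rw [pow_one]
    exact Conj.refl _
  | succ n ih =>
    intro t ht g
    have hc : (comb (n + 1)).length = n + 1 := length_comb n.succ_pos
    refine ((Conj.refl _).tensor (Conj.id (t' := leaf * comb (n + 1)) ?_)).trans ?_
    · rw [ht, length_mul, hc, length_leaf, Nat.add_comm]
    · rw [← RHom.tensor_id]
      refine (Conj.tensor_leaf rfl rfl _ _ _).trans ?_
      rw [← Gen.pre_pow_succ]
      exact ih (comb (n + 1)) hc (g.pre rho)

/-- Every edge is conjugate to the chosen edge of its class. -/
theorem IsEdge.conj_edge {g : Gen} {x y : Tree} {e : RHom all x y} (h : IsEdge g e) :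
    Conj e g.edge.2.2 := by
  induction h with
  | br f g h =>
    exact Conj.assoc (length_comb f.length_pos).symm (length_comb g.length_pos).symm
      (length_comb h.length_pos).symm
  | lam t X e _ ih =>
    refine ((Conj.refl _).tensor ih).trans ?_
    obtain ⟨n, hn⟩ := Nat.exists_eq_succ_of_ne_zero t.length_pos.ne'
    rw [hn]
    exact conj_edge_lam n t hn X
  | rho t X e _ ih =>
    refine (ih.tensor (Conj.refl _)).trans ?_
    obtain ⟨n, hn⟩ := Nat.exists_eq_succ_of_ne_zero t.length_pos.ne'
    rw [hn]
    exact conj_edge_rho n t hn X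

/-! ### The generators -/

theorem length_pow_of (l : Letter) (m : ℕ) :
    ((FreeMonoid.of l) ^ m : FreeMonoid Letter).length = m := by
  induction m with
  | zero => rfl
  | succ m ih => rw [pow_succ, FreeMonoid.length_mul, ih, FreeMonoid.length_of]

/-- The number of letters of the associations between which the edges of a class run. -/
def Gen.size (g : Gen) : ℕ := g.word.length + (g.i + g.j + g.k)

theorem Gen.size_pre (X : FreeMonoid Letter) (g : Gen) : (g.pre X).size = X.length + g.size := by
  rw [Gen.size, Gen.size, Gen.pre, FreeMonoid.length_mul, Nat.add_assoc]

/-- Each letter of the prefix adds one to the number of letters, whatever grouping into powers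
produced it. Hence membership is numerical, a symbol determines its `n`, and prefixing reflects
membership. -/
theorem isGen_iff {n : ℕ} {g : Gen} :
    IsGen n g ↔ 0 < g.i ∧ 0 < g.j ∧ 0 < g.k ∧ g.size = n := by
  constructor
  · intro h
    induction h with
    | lam i m hi y _ ih =>
      refine ⟨ih.1, ih.2.1, ih.2.2.1, ?_⟩
      rw [Gen.size_pre, ih.2.2.2, lam, length_pow_of]
    | rho i m hm x _ ih =>
      refine ⟨ih.1, ih.2.1, ih.2.2.1, ?_⟩
      rw [Gen.size_pre, ih.2.2.2, rho, length_pow_of, Nat.add_comm]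
    | br i j k hi hj hk => exact ⟨hi, hj, hk, Nat.zero_add _⟩
  · rintro ⟨hi, hj, hk, rfl⟩
    obtain ⟨X, i, j, k⟩ := g
    induction X using FreeMonoid.inductionOn' with
    | one =>
      have := IsGen.br i j k hi hj hk
      rwa [← Nat.zero_add (i + j + k)] at this
    | of_mul l X ih =>
      -- Prefixes with exponent one suffice to build every symbol.
      have e : (⟨FreeMonoid.of l * X, i, j, k⟩ : Gen) =
        (⟨X, i, j, k⟩ : Gen).pre (FreeMonoid.of l ^ 1) := by rw [pow_one]; rfl
      rw [e, Gen.size_pre, length_pow_of]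
      cases l with
      | lam => exact IsGen.lam 1 _ one_pos _ (ih hi hj hk)
      | rho =>
        rw [Nat.add_comm]
        exact IsGen.rho _ 1 one_pos _ (ih hi hj hk)

theorem isGen_pre_iff {m n : ℕ} {X : FreeMonoid Letter} {g : Gen} (h : X.length + m = n) :
    IsGen n (g.pre X) ↔ IsGen m g := by
  rw [isGen_iff, isGen_iff, Gen.size_pre, ← h, Nat.add_left_cancel_iff]
  rfl

theorem Gen.isEdge_edge {g : Gen} (hi : 0 < g.i) (hj : 0 < g.j) (hk : 0 < g.k) :
    IsEdge g g.edge.2.2 := by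
  obtain ⟨X, i, j, k⟩ := g
  induction X using FreeMonoid.inductionOn' with
  | one =>
    have := IsEdge.br (comb i) (comb j) (comb k)
    rwa [length_comb hi, length_comb hj, length_comb hk] at this
  | of_mul l X ih =>
    cases l with
    | lam => exact IsEdge.lam leaf _ _ (ih hi hj hk)
    | rho => exact IsEdge.rho leaf _ _ (ih hi hj hk)

theorem IsGen.isEdge {n : ℕ} {g : Gen} (h : IsGen n g) : IsEdge g g.edge.2.2 := by
  obtain ⟨hi, hj, hk, _⟩ := isGen_iff.1 h
  exact g.isEdge_edge hi hj hk

theorem IsGen.unique {m n : ℕ} {g : Gen} (h : IsGen m g) (h' : IsGen n g) : m = n :=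
  (isGen_iff.1 h).2.2.2.symm.trans (isGen_iff.1 h').2.2.2

theorem IsGen.length_edge {n : ℕ} {g : Gen} (h : IsGen n g) : g.edge.1.length = n :=
  h.isEdge.isGen.unique h

/-! ### Homomorphisms from the Catalan groupoids to groups -/

/-- A homomorphism from the groupoid `A_n` to a group that is trivial on `T_n`. -/
structure Rep (n : ℕ) (H : Type*) [Group H] where
  toFun : ∀ {x y : Tree}, x.length = n → RHom all x y → H
  map_comp : ∀ {x y z : Tree} (hx : x.length = n) (hy : y.length = n) (f : RHom all x y)
    (g : RHom all y z), toFun hx (f.comp g) = toFun hx f * toFun hy g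
  map_incl : ∀ {x y : Tree} (hx : x.length = n) (f : RHom one x y), toFun hx f.incl = 1

namespace Rep

variable {n : ℕ} {H : Type*} [Group H]

theorem map_id (θ : Rep n H) {x : Tree} (hx : x.length = n) : θ.toFun hx (RHom.id x) = 1 :=
  θ.map_incl hx (RHom.id x)

/-- The two connecting morphisms lie in `T_n`, where `θ` is trivial. -/
theorem eq_of_conj (θ : Rep n H) {x y x' y' : Tree} {e : RHom all x y} {e' : RHom all x' y'}
    (h : Conj e e') (hx : x.length = n) (hx' : x'.length = n) :
    θ.toFun hx e = θ.toFun hx' e' := by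
  obtain ⟨s, t, h⟩ := h
  have := congrArg (θ.toFun hx) h
  rwa [θ.map_comp hx (e.length_eq.symm.trans hx), θ.map_comp hx hx', θ.map_incl, θ.map_incl,
    mul_one, one_mul] at this

open Classical in
/-- The common value at the edges of a class. -/
noncomputable def gen (θ : Rep n H) (g : Gen) : H :=
  -- The default value 1 outside `G_n` extends the assignment to all symbols, as needed to evaluate
  -- relators in the free group on `Gen`.
  if h : IsGen n g then θ.toFun h.length_edge g.edge.2.2 else 1

theorem eq_gen (θ : Rep n H) {g : Gen} {x y : Tree} {e : RHom all x y} (h : IsEdge g e)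
    (hx : x.length = n) : θ.toFun hx e = θ.gen g := by
  have hg : IsGen n g := hx ▸ h.isGen
  rw [gen, dif_pos hg]
  exact θ.eq_of_conj h.conj_edge _ _

theorem gen_of_not (θ : Rep n H) {g : Gen} (h : ¬ IsGen n g) : θ.gen g = 1 := dif_neg h

/-- The restriction along `t ⊗ -`. -/
def left (θ : Rep n H) (t : Tree) {m : ℕ} (h : t.length + m = n) : Rep m H where
  toFun hx f := θ.toFun (length_mul_left hx h) ((RHom.id t).tensor f)
  map_comp hx hy f g := by
    rw [← θ.map_comp, ← RHom.tensor_comp, RHom.id_comp]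
  map_incl hx f := by
    have := θ.map_incl (length_mul_left hx h) ((RHom.id t).tensor f)
    rwa [RHom.incl_tensor] at this

/-- The restriction along `- ⊗ t`. -/
def right (θ : Rep n H) (t : Tree) {m : ℕ} (h : m + t.length = n) : Rep m H where
  toFun hx f := θ.toFun (length_mul_right hx h) (f.tensor (RHom.id t))
  map_comp hx hy f g := by
    rw [← θ.map_comp, ← RHom.tensor_comp, RHom.id_comp]
  map_incl hx f := by
    have := θ.map_incl (length_mul_right hx h) (f.tensor (RHom.id t))
    rwa [RHom.incl_tensor] at this

/-- Tensoring an edge of class `g` with `t` gives an edge of the prefixed class. Outside `G_m` both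
sides are the default value, since prefixing reflects membership. -/
theorem gen_left (θ : Rep n H) (t : Tree) {m : ℕ} (h : t.length + m = n) (g : Gen) :
    (θ.left t h).gen g = θ.gen (g.pre (lam ^ t.length)) := by
  by_cases hg : IsGen m g
  · rw [← (θ.left t h).eq_gen hg.isEdge hg.length_edge]
    exact θ.eq_gen (.lam t g _ hg.isEdge) _
  · rw [gen_of_not _ hg, gen_of_not]
    rwa [isGen_pre_iff (m := m)]
    rw [lam, length_pow_of, h]

theorem gen_right (θ : Rep n H) (t : Tree) {m : ℕ} (h : m + t.length = n) (g : Gen) :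
    (θ.right t h).gen g = θ.gen (g.pre (rho ^ t.length)) := by
  by_cases hg : IsGen m g
  · rw [← (θ.right t h).eq_gen hg.isEdge hg.length_edge]
    exact θ.eq_gen (.rho t g _ hg.isEdge) _
  · rw [gen_of_not _ hg, gen_of_not]
    rwa [isGen_pre_iff (m := m)]
    rw [rho, length_pow_of, Nat.add_comm, h]

theorem lift_map {α β : Type*} (f : α → β) (u : β → H) (v : α → H) (h : ∀ a, v a = u (f a))
    (r : FreeGroup α) : FreeGroup.lift u (FreeGroup.map f r) = FreeGroup.lift v r := by
  have e : (FreeGroup.lift u).comp (FreeGroup.map f) = FreeGroup.lift v :=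
    FreeGroup.ext_hom _ _ fun a => by simp [h]
  exact DFunLike.congr_fun e r

/-- Naturality of the reassociations, for the values at edges. -/
theorem naturality (θ : Rep n H) {x y z x' y' z' : Tree} (f : RHom all x x') (g : RHom all y y')
    (h : RHom all z z') (hn : (x * (y * z)).length = n) {a b : Gen}
    (ha : IsEdge a (f.tensor (g.tensor h))) (hb : IsEdge b ((f.tensor g).tensor h)) :
    θ.gen (br x.length y.length z.length) * θ.gen b *
      (θ.gen (br x.length y.length z.length))⁻¹ * (θ.gen a)⁻¹ = 1 := by
  have hn' : (x * y * z).length = n := (Nat.add_assoc _ _ _).trans hn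
  have hn'' : (x' * (y' * z')).length = n := (f.tensor (g.tensor h)).length_eq.symm.trans hn
  have e := congrArg (θ.toFun hn) (RHom.naturality f g h trivial trivial)
  have hbr := IsEdge.br x' y' z'
  rw [← f.length_eq, ← g.length_eq, ← h.length_eq] at hbr
  rw [θ.map_comp hn hn'', θ.map_comp hn hn', θ.eq_gen ha, θ.eq_gen hb, θ.eq_gen hbr,
    θ.eq_gen (IsEdge.br x y z)] at e
  rw [← e, mul_inv_cancel_right, mul_inv_cancel]

/-- The statement ranges over all `θ` because prefixed relators are handled by restricting `θ` along
`t ⊗ -` or `- ⊗ t` and applying the induction hypothesis to the restriction. -/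
theorem lift_gen_eq_one {n : ℕ} {r : FreeGroup Gen} (hr : IsRel n r) :
    ∀ θ : Rep n H, FreeGroup.lift θ.gen r = 1 := by
  induction hr with
  | left i j k hi hj hk x hx =>
    intro θ
    have h₁ := IsEdge.rho (comb j * comb k) x _ hx.isEdge
    have h₂ := IsEdge.rho (comb k) _ _ (IsEdge.rho (comb j) x _ hx.isEdge)
    -- The identity of a product is split so that the edge of class `ρ ^ (j + k) x` reads `e ⊗ (1 ⊗
    -- 1)`, a side of the naturality square.
    rw [← RHom.tensor_id] at h₁
    have := θ.naturality _ _ _ (by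
      rw [length_mul, length_mul, hx.length_edge, length_comb hj, length_comb hk]; omega) h₁ h₂
    rw [Gen.pre_pre, length_mul, length_comb hj, length_comb hk, hx.length_edge] at this
    simpa using this
  | middle i j k hi hj hk y hy =>
    intro θ
    have h₁ := IsEdge.lam (comb i) _ _ (IsEdge.rho (comb k) y _ hy.isEdge)
    have h₂ := IsEdge.rho (comb k) _ _ (IsEdge.lam (comb i) y _ hy.isEdge)
    have := θ.naturality _ _ _ (by
      rw [length_mul, length_mul, hy.length_edge, length_comb hi, length_comb hk]; omega) h₁ h₂
    rw [Gen.pre_pre, Gen.pre_pre, length_comb hi, length_comb hk, hy.length_edge] at this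
    simpa using this
  | right i j k hi hj hk z hz =>
    intro θ
    have h₁ := IsEdge.lam (comb i) _ _ (IsEdge.lam (comb j) z _ hz.isEdge)
    have h₂ := IsEdge.lam (comb i * comb j) z _ hz.isEdge
    rw [← RHom.tensor_id] at h₂
    have := θ.naturality _ _ _ (by
      rw [length_mul, length_mul, hz.length_edge, length_comb hi, length_comb hj]; omega) h₁ h₂
    rw [Gen.pre_pre, length_mul, length_comb hi, length_comb hj, hz.length_edge] at this
    simpa using this
  | mis i k hi hk =>
    intro θ
    have h := IsEdge.br (comb i) leaf (comb k)
    rw [length_comb hi, length_comb hk] at h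
    rw [FreeGroup.lift_apply_of]
    have hl : (comb i * (leaf * comb k)).length = i + 1 + k := by
      rw [length_mul, length_mul, length_comb hi, length_comb hk, length_leaf, Nat.add_assoc]
    exact (θ.eq_gen h hl).symm.trans (θ.map_incl hl (RHom.assoc (comb i) leaf (comb k) rfl))
  | lam i m hi r _ ih =>
    intro θ
    have hc := length_comb hi
    rw [lift_map _ _ (θ.left (comb i) (by rw [hc])).gen, ih]
    intro g
    rw [gen_left, hc]
  | rho i m hm r _ ih =>
    intro θ
    have hc := length_comb hm
    rw [lift_map _ _ (θ.right (comb m) (by rw [hc])).gen, ih]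
    intro g
    rw [gen_right, hc]
  | comm i m x y hx hy =>
    intro θ
    have hl : (x.edge.1 * y.edge.1).length = i + m := by
      rw [length_mul, hx.length_edge, hy.length_edge]
    have hm := hy.isEdge.isGen.unique hy
    have hi := hx.isEdge.isGen.unique hx
    have h₁ : ∀ t : Tree, t.length = m →
        IsEdge (x.pre (Catalan.rho ^ m)) (x.edge.2.2.tensor (RHom.id t)) := fun t ht =>
      ht ▸ IsEdge.rho t x _ hx.isEdge
    have h₂ : ∀ t : Tree, t.length = i →
        IsEdge (y.pre (Catalan.lam ^ i)) ((RHom.id t).tensor y.edge.2.2) := fun t ht =>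
      ht ▸ IsEdge.lam t y _ hy.isEdge
    -- Interchange: both factorizations of the tensor product of the two chosen edges have the same
    -- value.
    have e := congrArg (θ.toFun hl) ((RHom.tensor_eq_left_right x.edge.2.2 y.edge.2.2).symm.trans
      (RHom.tensor_eq_right_left x.edge.2.2 y.edge.2.2))
    have lx := x.edge.2.2.length_eq
    have ly := y.edge.2.2.length_eq
    rw [θ.map_comp hl (by rw [length_mul, ← lx, hi, hm]), θ.map_comp hl
      (by rw [length_mul, ← ly, hi, hm]), θ.eq_gen (h₁ _ hm), θ.eq_gen (h₁ _ (ly ▸ hm)),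
      θ.eq_gen (h₂ _ hi), θ.eq_gen (h₂ _ (lx ▸ hi))] at e
    simp [e]

/-! ### Factoring a homomorphism through the classes -/

/-- The induced homomorphism on the presented group. -/
noncomputable def hom (θ : Rep n H) : Pres n →* H :=
  PresentedGroup.toGroup (f := fun g : G n => θ.gen g.1) fun r hr => by
    rw [← lift_map Subtype.val θ.gen _ fun _ => rfl]
    exact lift_gen_eq_one hr θ

theorem hom_of (θ : Rep n H) (g : G n) : θ.hom (PresentedGroup.of g) = θ.gen g.1 :=
  PresentedGroup.toGroup.of _

theorem hom_left (θ : Rep n H) (t : Tree) {m : ℕ} (h : t.length + m = n) (a : Pres m) :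
    (θ.left t h).hom a = θ.hom (lamHom t.length_pos h a) := by
  have e : (θ.left t h).hom = θ.hom.comp (lamHom t.length_pos h) :=
    PresentedGroup.ext fun g => by
      rw [hom_of, MonoidHom.comp_apply, lamHom_of, hom_of, gen_left]
      rfl
  exact DFunLike.congr_fun e a

theorem hom_right (θ : Rep n H) (t : Tree) {m : ℕ} (h : m + t.length = n) (a : Pres m) :
    (θ.right t h).hom a = θ.hom (rhoHom t.length_pos h a) := by
  have e : (θ.right t h).hom = θ.hom.comp (rhoHom t.length_pos h) :=
    PresentedGroup.ext fun g => by
      rw [hom_of, MonoidHom.comp_apply, rhoHom_of, hom_of, gen_right]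
      rfl
  exact DFunLike.congr_fun e a

/-- Induction on the word with `θ` arbitrary: in a tensor product the two factors are evaluated by
restrictions of `θ`, which `hom_right` and `hom_left` match with the prefixes. -/
theorem hom_wordVal {x y : Tree} (f : Word all x y) :
    ∀ {n : ℕ} (θ : Rep n H) (h : x.length = n), θ.hom (wordVal f h) = θ.toFun h (RHom.mk f) := by
  induction f with
  | id x => intro n θ h; exact (_root_.map_one _).trans (θ.map_id h).symm
  | comp f g ihf ihg =>
    intro n θ h
    exact (_root_.map_mul _ _ _).trans ((congrArg₂ (· * ·) (ihf θ _) (ihg θ _)).trans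
      (θ.map_comp _ _ _ _).symm)
  | inv f ih =>
    intro n θ h
    refine (_root_.map_inv _ _).trans ((congrArg (·⁻¹) (ih θ (f.length_eq.trans h))).trans ?_)
    refine inv_eq_of_mul_eq_one_right ((θ.map_comp _ _ _ (RHom.mk f).inv).symm.trans ?_)
    refine (congrArg (θ.toFun _) (Quotient.sound (.comp_inv f))).trans (θ.map_id _)
  | @tensor x y x' y' f g ihf ihg =>
    intro n θ h
    have h' : x.length + x'.length = n := h
    have hy : y.length + x'.length = n := f.length_eq ▸ h'
    have e : θ.toFun h (RHom.mk (f.tensor g)) = _ :=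
      congrArg (θ.toFun h) (RHom.tensor_eq_left_right (RHom.mk f) (RHom.mk g))
    rw [e, θ.map_comp h (show (y * x').length = n from hy)]
    have e₁ := (ihf (θ.right x' h') rfl).symm.trans (θ.hom_right x' h' _)
    have e₂ := (ihg (θ.left y hy) rfl).symm.trans (θ.hom_left y hy _)
    refine (_root_.map_mul _ _ _).trans (congrArg₂ (· * ·) e₁.symm (Eq.trans ?_ e₂.symm))
    congr 1
    -- The class uses the prefix `λ ^ x.length`, whereas factoring through `y ⊗ x'` produces `λ ^
    -- y.length`; the two lengths agree.
    have aux : ∀ {a b : ℕ} (ha : 0 < a) (hb : 0 < b) (h₁ : a + x'.length = n)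
      (h₂ : b + x'.length = n), lamHom ha h₁ = lamHom hb h₂ := by
      intro a b ha hb h₁ h₂
      obtain rfl : a = b := by omega
      rfl
    exact DFunLike.congr_fun (aux _ _ h' hy) _
  | assoc x y z hy =>
    intro n θ h
    exact (θ.hom_of _).trans (θ.eq_gen (IsEdge.br x y z) h).symm

theorem hom_homVal (θ : Rep n H) {x y : Tree} (f : RHom all x y) (h : x.length = n) :
    θ.hom (homVal f h) = θ.toFun h f := by
  obtain ⟨f⟩ := f
  exact hom_wordVal f θ h

end Rep

/-! ### The universal property of the presented group -/

section Desc

variable {n : ℕ} {C : Type} [Category.{0} C] (F : A n ⥤ C) (Q : Discrete PUnit ⥤ C)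
  (comm : L n ⋙ F = collapse n ⋙ Q)

theorem obj_eq {n : ℕ} {C : Type} [Category.{0} C] (F : A n ⥤ C) (Q : Discrete PUnit ⥤ C)
    (comm : L n ⋙ F = collapse n ⋙ Q) (x : A n) : F.obj x = Q.obj ⟨PUnit.unit⟩ :=
  Functor.congr_obj comm (⟨x.tree, x.len⟩ : T n)

/-- The homomorphism to the automorphism group of the base point. -/
def autRep : Rep n (Aut (Q.obj ⟨PUnit.unit⟩))ᵐᵒᵖ where
  -- Multiplication in `Aut` reverses diagrammatic order, whence the opposite group. The objects
  -- `F.obj x` equal the base point only propositionally, whence the conjugation by `eqToIso`.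
  toFun {x y} hx f := .op (eqToIso (obj_eq F Q comm ⟨x, hx⟩).symm ≪≫
    F.mapIso ((Groupoid.isoEquivHom (⟨x, hx⟩ : A n) ⟨y, f.length_eq.symm.trans hx⟩).symm f) ≪≫
      eqToIso (obj_eq F Q comm _))
  map_comp {x y z} hx hy f g := by
    have hz : z.length = n := g.length_eq.symm.trans hy
    refine MulOpposite.unop_injective (Iso.ext ?_)
    change _ ≫ F.map ((show (⟨x, hx⟩ : A n) ⟶ ⟨y, hy⟩ from f) ≫
      (show (⟨y, hy⟩ : A n) ⟶ ⟨z, hz⟩ from g)) ≫ _ = (_ ≫ F.map _ ≫ _) ≫ (_ ≫ F.map _ ≫ _)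
    rw [F.map_comp]
    simp
  map_incl {x y} hx f := by
    refine MulOpposite.unop_injective (Iso.ext ?_)
    have e := Functor.hcongr_hom comm
      (show (⟨x, hx⟩ : T n) ⟶ ⟨y, f.length_eq.symm.trans hx⟩ from f)
    refine eq_of_heq ((conj_heq _ _ _).trans (e.trans ?_))
    exact heq_of_eq (Q.map_id _)

/-- The functor out of the presented group. -/
noncomputable def desc : deloop (Pres n) ⥤ C where
  obj _ := Q.obj ⟨PUnit.unit⟩
  map f := ((autRep F Q comm).hom (MulOpposite.unop f)).unop.hom
  map_id _ := by
    change ((autRep F Q comm).hom 1).unop.hom = _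
    rw [map_one]
    rfl
  map_comp f g := by
    change ((autRep F Q comm).hom (MulOpposite.unop f * MulOpposite.unop g)).unop.hom = _
    rw [map_mul]
    rfl

theorem classFunctor_desc : classFunctor n ⋙ desc F Q comm = F := by
  refine CategoryTheory.Functor.hext (fun x => (obj_eq F Q comm x).symm) ?_
  intro x y f
  change ((autRep F Q comm).hom (homVal f x.len)).unop.hom ≍ _
  rw [Rep.hom_homVal]
  exact conj_heq _ _ _

theorem const_desc : (Functor.const (Discrete PUnit)).obj (SingleObj.star (Pres n)ᵐᵒᵖ) ⋙
    desc F Q comm = Q := by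
  refine CategoryTheory.Functor.hext (fun _ => rfl) ?_
  rintro ⟨⟨⟩⟩ ⟨⟨⟩⟩ f
  obtain rfl : f = 𝟙 _ := Subsingleton.elim _ _
  exact heq_of_eq ((CategoryTheory.Functor.map_id _ _).trans (Q.map_id _).symm)

end Desc

theorem deloop_ext {n : ℕ} (hn : 1 ≤ n) {C : Type} [Category.{0} C]
    {K K' : SingleObj (Pres n)ᵐᵒᵖ ⥤ C} (h : classFunctor n ⋙ K = classFunctor n ⋙ K') : K = K' := by
  have ho : ∀ x, K.obj x = K'.obj x := fun x =>
    -- Positivity of `n` enters here: `A_n` must have an object for the class functor to reach the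
    -- object of the group.
    Functor.congr_obj h (⟨comb n, length_comb hn⟩ : A n)
  refine CategoryTheory.Functor.hext ho ?_
  -- The elements on which `K` and `K'` agree form a subgroup. It contains every generator, since
  -- each is the class of its chosen edge.
  let S : Subgroup (Pres n) :=
    { carrier := {a | K.map (X := SingleObj.star _) (Y := SingleObj.star _) (MulOpposite.op a) ≍
        K'.map (X := SingleObj.star _) (Y := SingleObj.star _) (MulOpposite.op a)}
      one_mem' := by
        change K.map (𝟙 (SingleObj.star (Pres n)ᵐᵒᵖ)) ≍ K'.map (𝟙 (SingleObj.star (Pres n)ᵐᵒᵖ))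
        rw [K.map_id, K'.map_id]
        exact id_heq (ho _)
      mul_mem' := by
        intro a b ha hb
        let a' : SingleObj.star (Pres n)ᵐᵒᵖ ⟶ SingleObj.star (Pres n)ᵐᵒᵖ := MulOpposite.op a
        let b' : SingleObj.star (Pres n)ᵐᵒᵖ ⟶ SingleObj.star (Pres n)ᵐᵒᵖ := MulOpposite.op b
        change K.map (a' ≫ b') ≍ K'.map (a' ≫ b')
        rw [K.map_comp, K'.map_comp]
        exact comp_heq (ho _) (ho _) (ho _) ha hb
      inv_mem' := by
        intro a ha
        let e : SingleObj.star (Pres n)ᵐᵒᵖ ≅ SingleObj.star (Pres n)ᵐᵒᵖ :=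
          ⟨MulOpposite.op a, MulOpposite.op a⁻¹,
            congrArg MulOpposite.op (mul_inv_cancel a), congrArg MulOpposite.op (inv_mul_cancel a)⟩
        exact inv_heq (e := K.mapIso e) (e' := K'.mapIso e) (ho _) (ho _) ha }
  have hS : ∀ a : Pres n, a ∈ S := by
    refine PresentedGroup.generated_by _ S fun g => ?_
    have e := Functor.hcongr_hom h (X := ⟨g.1.edge.1, g.2.length_edge⟩)
      (Y := ⟨g.1.edge.2.1, g.1.edge.2.2.length_eq.symm.trans g.2.length_edge⟩) g.1.edge.2.2
    have e' := homVal_of_isEdge g.2.isEdge g.2.length_edge g.2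
    change K.map (MulOpposite.op (homVal _ _)) ≍ K'.map (MulOpposite.op (homVal _ _)) at e
    rw [e'] at e
    exact e
  exact fun _ _ f => hS (MulOpposite.unop f)

/-- The presented group is the pushout of `A_n ← T_n → 1`. -/
theorem isPushout_classFunctor {n : ℕ} (hn : 1 ≤ n) :
    IsPushout (L n).toCatHom (collapse n).toCatHom (Y := Cat.of (Discrete PUnit))
      (P := deloop (Pres n)) (classFunctor n).toCatHom
      ((Functor.const _).obj (SingleObj.star (Pres n)ᵐᵒᵖ)).toCatHom where
  w := Cat.ext (L_classFunctor n)
  isColimit' := ⟨PushoutCocone.IsColimit.mk _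
    (fun s => (desc s.inl.toFunctor s.inr.toFunctor
      (congrArg Cat.Hom.toFunctor s.condition)).toCatHom)
    (fun _ => Cat.ext (classFunctor_desc _ _ _))
    (fun _ => Cat.ext (const_desc _ _ _))
    (fun _ _ h₁ _ => Cat.ext (deloop_ext hn
      ((congrArg Cat.Hom.toFunctor h₁).trans (classFunctor_desc _ _ _).symm)))⟩

/-- The fundamental group is the presented group. -/
noncomputable def fundamentalIso {n : ℕ} (hn : 1 ≤ n) : fundamental n ≅ deloop (Pres n) :=
  (isPushout_classFunctor hn).isoPushout.symm

theorem proj_fundamentalIso {n : ℕ} (hn : 1 ≤ n) :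
    proj n ⋙ (fundamentalIso hn).hom.toFunctor = classFunctor n :=
  congrArg Cat.Hom.toFunctor (isPushout_classFunctor hn).inl_isoPushout_inv

theorem deloop_elem_proj {n : ℕ} (hn : 1 ≤ n) (g : G n) {x y : A n} (f : x ⟶ y)
    (hf : IsEdge g.1 f) :
    deloop.elem ((proj n ⋙ (fundamentalIso hn).hom.toFunctor).map f) = PresentedGroup.of g := by
  -- The type of the mapped morphism depends on the functor, so the equality of functors is applied
  -- by substituting for a variable `K`.
  have aux : ∀ K : A n ⥤ deloop (Pres n), K = classFunctor n →
      deloop.elem (K.map f) = homVal f x.len := by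
    rintro _ rfl
    rfl
  rw [aux _ (proj_fundamentalIso hn)]
  exact homVal_of_isEdge hf x.len g.2

/-! ### Small numbers of letters -/

/-- Isomorphic groups have isomorphic one-object categories. -/
def deloopIso {H K : Type} [Group H] [Group K] (e : H ≃* K) : deloop H ≅ deloop K where
  hom := (SingleObj.mapHom _ _ e.toMonoidHom.op).toCatHom
  inv := (SingleObj.mapHom _ _ e.symm.toMonoidHom.op).toCatHom
  hom_inv_id := Cat.ext (CategoryTheory.Functor.hext (fun _ => rfl) fun _ _ f => heq_of_eq
    (congrArg MulOpposite.op (e.symm_apply_apply (MulOpposite.unop f))))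
  inv_hom_id := Cat.ext (CategoryTheory.Functor.hext (fun _ => rfl) fun _ _ f => heq_of_eq
    (congrArg MulOpposite.op (e.apply_symm_apply (MulOpposite.unop f))))

theorem IsGen.three_le {n : ℕ} {g : Gen} (h : IsGen n g) : 3 ≤ n := by
  obtain ⟨_, _, _, h⟩ := isGen_iff.1 h
  rw [Gen.size] at h
  omega

/-- A middle factor of two letters requires at least four letters in all. This count is what makes
most relations vacuous for small `n`. -/
theorem IsGen.middle_eq_one {n : ℕ} {g : Gen} (h : IsGen n g) (hn : n ≤ 3) : g.j = 1 := by
  obtain ⟨_, _, _, h⟩ := isGen_iff.1 h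
  rw [Gen.size] at h
  omega

theorem IsGen.eq_br {g : Gen} (h : IsGen 4 g) (hj : g.j ≠ 1) : g = Catalan.br 1 2 1 := by
  obtain ⟨_, _, _, h⟩ := isGen_iff.1 h
  obtain ⟨X, i, j, k⟩ := g
  rw [Gen.size] at h
  dsimp only at *
  obtain rfl : X = 1 := FreeMonoid.length_eq_zero.1 (by omega)
  obtain ⟨rfl, rfl, rfl⟩ : i = 1 ∧ j = 2 ∧ k = 1 := by omega
  rfl

/-- The symbol `λρ<1,2,1>`. -/
def lamRho : Gen := (br 1 2 1).pre (lam * rho)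

/-- The symbol `ρλ<1,2,1>`. -/
def rhoLam : Gen := (br 1 2 1).pre (rho * lam)

/-! ### Reducing the relations for at most six letters -/

/-- For at most six letters, the relations that do not just identify a class `X<i,1,k>` with the
neutral element amount to a single one. -/
theorem lift_eq_one {H : Type*} [Group H] {n : ℕ} {r : FreeGroup Gen} (hr : IsRel n r) :
    ∀ u : Gen → H, n ≤ 6 → (∀ g, g.j = 1 → u g = 1) →
      (n = 6 → u (br 1 4 1) * u rhoLam * (u (br 1 4 1))⁻¹ = u lamRho) →
      FreeGroup.lift u r = 1 := by
  induction hr with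
  | left i j k hi hj hk x hx =>
    intro u hn h₁ _
    simp only [map_mul, map_inv, FreeGroup.lift_apply_of]
    rw [← pow_add, Nat.add_comm k j]
    by_cases h : x.j = 1
    · rw [h₁ (x.pre _) h]; simp
    -- A nontrivial `x` needs `i ≥ 4`, so `j + k ≤ 2`: the bracket is trivial, and the two prefixed
    -- symbols are the same.
    · have : ¬ i ≤ 3 := fun h' => h (hx.middle_eq_one h')
      obtain rfl : j = 1 := by omega
      rw [h₁ (br i 1 k) rfl]; simp
  | middle i j k hi hj hk y hy =>
    intro u hn h₁ h₂
    simp only [map_mul, map_inv, FreeGroup.lift_apply_of]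
    by_cases h : y.j = 1
    · rw [h₁ (y.pre _) h, h₁ (y.pre _) h]; simp
    · have : ¬ j ≤ 3 := fun h' => h (hy.middle_eq_one h')
      -- The sole surviving case: six letters, with `y = <1,2,1>` in the middle.
      obtain ⟨rfl, rfl, rfl⟩ : i = 1 ∧ j = 4 ∧ k = 1 := by omega
      obtain rfl := hy.eq_br h
      rw [pow_one, pow_one, mul_inv_eq_one]
      exact h₂ rfl
  | right i j k hi hj hk z hz =>
    intro u hn h₁ _
    simp only [map_mul, map_inv, FreeGroup.lift_apply_of]
    rw [← pow_add]
    by_cases h : z.j = 1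
    · rw [h₁ (z.pre _) h]; simp
    · have : ¬ k ≤ 3 := fun h' => h (hz.middle_eq_one h')
      obtain rfl : j = 1 := by omega
      rw [h₁ (br i 1 k) rfl]; simp
  | mis i k hi hk =>
    intro u hn h₁ _
    rw [FreeGroup.lift_apply_of]
    exact h₁ _ rfl
  | lam i m hi r _ ih =>
    intro u hn h₁ _
    rw [Rep.lift_map _ _ (fun g : Gen => u (g.pre (Catalan.lam ^ i))) fun _ => rfl]
    -- A properly prefixed relator comes from fewer than six letters, where the exceptional
    -- condition is vacuous.
    exact ih _ (by omega) (fun g hg => h₁ _ hg) (fun _ => by omega)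
  | rho i m hm r _ ih =>
    intro u hn h₁ _
    rw [Rep.lift_map _ _ (fun g : Gen => u (g.pre (Catalan.rho ^ m))) fun _ => rfl]
    exact ih _ (by omega) (fun g hg => h₁ _ hg) (fun _ => by omega)
  | comm i m x y hx hy =>
    intro u hn h₁ _
    simp only [map_mul, map_inv, FreeGroup.lift_apply_of]
    have := hx.three_le
    have := hy.three_le
    -- Each factor needs at least three letters, so each has exactly three and both classes are
    -- trivial.
    rw [h₁ (x.pre _) (hx.middle_eq_one (by omega)), h₁ (y.pre _) (hy.middle_eq_one (by omega))]
    simp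

/-! ### Eliminating the redundant generators -/

/-- The generators of `G_n` that are not redundant when `n ≤ 6`. -/
def IsFreeGen (n : ℕ) (g : Gen) : Prop := IsGen n g ∧ g.j ≠ 1 ∧ g ≠ lamRho

open Classical in
/-- The generators of `G_n`, expressed by those that are not redundant. -/
noncomputable def freeVal (n : ℕ) (g : Gen) : FreeGroup {g : Gen // IsFreeGen n g} :=
  if h : IsFreeGen n g then .of ⟨g, h⟩
  -- The eliminated symbol is replaced by its conjugate expression. The membership conditions hold
  -- only for `n = 6` and make the free generators available.
  else if h : g = lamRho ∧ IsFreeGen n (br 1 4 1) ∧ IsFreeGen n rhoLam then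
    .of ⟨_, h.2.1⟩ * .of ⟨_, h.2.2⟩ * (.of ⟨_, h.2.1⟩)⁻¹
  else 1

theorem lamRho_middle : lamRho.j ≠ 1 := by decide

theorem rhoLam_ne : rhoLam ≠ lamRho := fun h => by
  have := congrArg (fun g => (FreeMonoid.toList g.word).head?) h
  exact Letter.noConfusion (Option.some.inj this)

theorem br_ne_lamRho (i j k : ℕ) : br i j k ≠ lamRho := fun h => by
  have := congrArg (fun g => (FreeMonoid.toList g.word).head?) h
  exact absurd this (Option.some_ne_none _).symm

theorem isFreeGen_br : IsFreeGen 6 (br 1 4 1) :=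
  ⟨IsGen.br 1 4 1 one_pos (by norm_num) one_pos, by decide, br_ne_lamRho 1 4 1⟩

theorem isFreeGen_rhoLam : IsFreeGen 6 rhoLam :=
  ⟨isGen_iff.2 ⟨one_pos, two_pos, one_pos, rfl⟩, by decide, rhoLam_ne⟩

theorem isGen_lamRho : IsGen 6 lamRho := isGen_iff.2 ⟨one_pos, two_pos, one_pos, rfl⟩

theorem freeVal_of {n : ℕ} {g : Gen} (h : IsFreeGen n g) : freeVal n g = .of ⟨g, h⟩ := dif_pos h

theorem freeVal_lamRho : freeVal 6 lamRho =
    .of ⟨_, isFreeGen_br⟩ * .of ⟨_, isFreeGen_rhoLam⟩ * (.of ⟨_, isFreeGen_br⟩)⁻¹ := by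
  rw [freeVal, dif_neg (fun h => h.2.2 rfl), dif_pos ⟨rfl, isFreeGen_br, isFreeGen_rhoLam⟩]

theorem freeVal_eq_one {n : ℕ} {g : Gen} (h : g.j = 1) : freeVal n g = 1 := by
  rw [freeVal, dif_neg (fun h' => h'.2.1 h), dif_neg]
  rintro ⟨rfl, _⟩
  exact lamRho_middle h

/-- The homomorphism from the presented group to the free group. -/
noncomputable def toFree {n : ℕ} (hn : n ≤ 6) : Pres n →* FreeGroup {g : Gen // IsFreeGen n g} :=
  PresentedGroup.toGroup (f := fun g : G n => freeVal n g.1) fun r hr => by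
    rw [← Rep.lift_map Subtype.val (freeVal n) _ fun _ => rfl]
    refine lift_eq_one hr _ hn (fun _ => freeVal_eq_one) ?_
    rintro rfl
    rw [freeVal_lamRho, freeVal_of isFreeGen_br, freeVal_of isFreeGen_rhoLam]

/-- The homomorphism from the free group to the presented group. -/
def ofFree (n : ℕ) : FreeGroup {g : Gen // IsFreeGen n g} →* Pres n :=
  FreeGroup.lift fun g => .of ⟨g.1, g.2.1⟩

/-- Prefixing the relators of kind 2 through kind 3 kills every `X<i,1,k>`. -/
theorem isRel_of_middle_eq_one {n : ℕ} {g : Gen} (h : IsGen n g) (hg : g.j = 1) :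
    IsRel n (fr g) := by
  induction h with
  | lam i m hi y _ ih => simpa using IsRel.lam i m hi _ (ih hg)
  | rho i m hm x _ ih => simpa using IsRel.rho i m hm _ (ih hg)
  | br i j k hi hj hk =>
    obtain rfl : j = 1 := hg
    exact IsRel.mis i k hi hk

theorem of_eq_one {n : ℕ} (g : G n) (hg : g.1.j = 1) : (PresentedGroup.of g : Pres n) = 1 :=
  mk_eq_one (r := FreeGroup.of g) (by simpa using isRel_of_middle_eq_one g.2 hg)

theorem ofFree_comp_toFree {n : ℕ} (hn : n ≤ 6) :
    (ofFree n).comp (toFree hn) = MonoidHom.id (Pres n) := by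
  refine PresentedGroup.ext fun g => ?_
  rw [MonoidHom.comp_apply, toFree, PresentedGroup.toGroup.of]
  by_cases hj : g.1.j = 1
  · rw [freeVal_eq_one hj, map_one, of_eq_one g hj, map_one]
  by_cases hg : g.1 = lamRho
  · obtain ⟨g, h⟩ := g
    dsimp only at hg
    subst hg
    obtain rfl := isGen_lamRho.unique h
    rw [freeVal_lamRho]
    simp only [ofFree, map_mul, map_inv, FreeGroup.lift_apply_of, MonoidHom.id_apply]
    have h : IsGen 4 (br 1 2 1) := IsGen.br 1 2 1 one_pos two_pos one_pos
    -- This is the relation that recovers `λρ<1,2,1>` from the free generators.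
    have := IsRel.middle 1 4 1 one_pos (by norm_num) one_pos _ h
    rw [pow_one, pow_one] at this
    refine eq_of_mul_inv_eq_one (mk_eq_one (r := FreeGroup.of _ * FreeGroup.of _ *
      (FreeGroup.of _)⁻¹ * (FreeGroup.of _)⁻¹) ?_)
    simpa [lamRho, rhoLam] using this
  · rw [freeVal_of ⟨g.2, hj, hg⟩, ofFree, FreeGroup.lift_apply_of]
    rfl

theorem toFree_comp_ofFree {n : ℕ} (hn : n ≤ 6) :
    (toFree hn).comp (ofFree n) = MonoidHom.id _ := by
  refine FreeGroup.ext_hom _ _ fun g => ?_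
  rw [MonoidHom.comp_apply, ofFree, FreeGroup.lift_apply_of, toFree, PresentedGroup.toGroup.of,
    freeVal_of g.2]
  rfl

/-- For at most six letters the presented group is free. -/
noncomputable def presEquivFree {n : ℕ} (hn : n ≤ 6) :
    Pres n ≃* FreeGroup {g : Gen // IsFreeGen n g} :=
  (toFree hn).toMulEquiv (ofFree n) (ofFree_comp_toFree hn) (toFree_comp_ofFree hn)

/-! ### Enumerating the irredundant generators -/

/-- The irredundant generators, enumerated by a list without repetitions. -/
noncomputable def equivFin {n : ℕ} (l : List Gen) (hl : l.Nodup) (h : ∀ g, IsFreeGen n g ↔ g ∈ l) :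
    {g : Gen // IsFreeGen n g} ≃ Fin l.length := by
  classical
  exact (Equiv.subtypeEquivRight h).trans (hl.getEquiv l).symm

instance : DecidableEq Letter
  | .lam, .lam => isTrue rfl
  | .lam, .rho => isFalse Letter.noConfusion
  | .rho, .lam => isFalse Letter.noConfusion
  | .rho, .rho => isTrue rfl

/-- The symbol with the given prefix. -/
abbrev sym (X : List Letter) (i j k : ℕ) : Gen := ⟨FreeMonoid.ofList X, i, j, k⟩

instance : DecidableEq Gen := fun g h =>
  decidable_of_iff (g.word.toList = h.word.toList ∧ g.i = h.i ∧ g.j = h.j ∧ g.k = h.k) <| by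
    obtain ⟨X, i, j, k⟩ := g
    obtain ⟨Y, i', j', k'⟩ := h
    simp

/-- An arithmetic and decidable form of irredundancy, by which the explicit lists are checked. -/
theorem isFreeGen_sym {n : ℕ} {X : List Letter} {i j k : ℕ} : IsFreeGen n (sym X i j k) ↔
    (0 < i ∧ 2 ≤ j ∧ 0 < k ∧ X.length + (i + j + k) = n) ∧
      sym X i j k ≠ sym [.lam, .rho] 1 2 1 := by
  rw [IsFreeGen, isGen_iff]
  have e : lamRho = sym [.lam, .rho] 1 2 1 := rfl
  have e' : (sym X i j k).size = X.length + (i + j + k) := rfl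
  rw [e, e', ← and_assoc]
  refine and_congr_left' ?_
  dsimp only
  omega

/-- The irredundant generators for four letters. -/
def freeGens₄ : List Gen := [sym [] 1 2 1]

/-- The irredundant generators for five letters. -/
def freeGens₅ : List Gen :=
  [sym [] 1 2 2, sym [] 2 2 1, sym [] 1 3 1, sym [.lam] 1 2 1, sym [.rho] 1 2 1]

/-- The irredundant generators for six letters. -/
def freeGens₆ : List Gen :=
  [sym [] 1 2 3, sym [] 2 2 2, sym [] 3 2 1, sym [] 1 3 2, sym [] 2 3 1, sym [] 1 4 1,
    sym [.lam] 1 2 2, sym [.lam] 2 2 1, sym [.lam] 1 3 1,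
    sym [.rho] 1 2 2, sym [.rho] 2 2 1, sym [.rho] 1 3 1,
    sym [.lam, .lam] 1 2 1, sym [.rho, .lam] 1 2 1, sym [.rho, .rho] 1 2 1]

theorem mem_freeGens₄ (g : Gen) : IsFreeGen 4 g ↔ g ∈ freeGens₄ := by
  constructor
  · intro h
    rw [h.1.eq_br h.2.1]
    decide
  · intro h
    obtain rfl := List.mem_singleton.1 h
    rw [isFreeGen_sym]
    decide

theorem mem_freeGens₅ (g : Gen) : IsFreeGen 5 g ↔ g ∈ freeGens₅ := by
  constructor
  · obtain ⟨X, i, j, k⟩ := g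
    obtain ⟨X, rfl⟩ := FreeMonoid.ofList.surjective X
    rw [isFreeGen_sym]
    rintro ⟨⟨hi, hj, hk, h⟩, _⟩
    match X, h with
    | [], h =>
      have h : i + j + k = 5 := by simpa using h
      obtain ⟨rfl, rfl, rfl⟩ | ⟨rfl, rfl, rfl⟩ | ⟨rfl, rfl, rfl⟩ :
        (i = 1 ∧ j = 2 ∧ k = 2) ∨ (i = 2 ∧ j = 2 ∧ k = 1) ∨ (i = 1 ∧ j = 3 ∧ k = 1) := by omega
      all_goals decide
    | [a], h =>
      have h : 1 + (i + j + k) = 5 := by simpa using h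
      obtain ⟨rfl, rfl, rfl⟩ : i = 1 ∧ j = 2 ∧ k = 1 := by omega
      cases a <;> decide
    | _ :: _ :: _, h =>
      simp only [List.length_cons] at h
      omega
  · intro h
    simp only [freeGens₅, List.mem_cons, List.not_mem_nil, or_false] at h
    rcases h with rfl | rfl | rfl | rfl | rfl <;> rw [isFreeGen_sym] <;> decide

theorem mem_freeGens₆ (g : Gen) : IsFreeGen 6 g ↔ g ∈ freeGens₆ := by
  constructor
  · obtain ⟨X, i, j, k⟩ := g
    obtain ⟨X, rfl⟩ := FreeMonoid.ofList.surjective X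
    rw [isFreeGen_sym]
    rintro ⟨⟨hi, hj, hk, h⟩, hne⟩
    match X, h, hne with
    | [], h, _ =>
      have h : i + j + k = 6 := by simpa using h
      obtain ⟨rfl, rfl, rfl⟩ | ⟨rfl, rfl, rfl⟩ | ⟨rfl, rfl, rfl⟩ | ⟨rfl, rfl, rfl⟩ |
          ⟨rfl, rfl, rfl⟩ | ⟨rfl, rfl, rfl⟩ :
        (i = 1 ∧ j = 2 ∧ k = 3) ∨ (i = 2 ∧ j = 2 ∧ k = 2) ∨ (i = 3 ∧ j = 2 ∧ k = 1) ∨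
          (i = 1 ∧ j = 3 ∧ k = 2) ∨ (i = 2 ∧ j = 3 ∧ k = 1) ∨ (i = 1 ∧ j = 4 ∧ k = 1) := by
        omega
      all_goals decide
    | [a], h, _ =>
      have h : 1 + (i + j + k) = 6 := by simpa using h
      obtain ⟨rfl, rfl, rfl⟩ | ⟨rfl, rfl, rfl⟩ | ⟨rfl, rfl, rfl⟩ :
        (i = 1 ∧ j = 2 ∧ k = 2) ∨ (i = 2 ∧ j = 2 ∧ k = 1) ∨ (i = 1 ∧ j = 3 ∧ k = 1) := by omega
      all_goals cases a <;> decide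
    | [a, b], h, hne =>
      have h : 2 + (i + j + k) = 6 := by simpa using h
      obtain ⟨rfl, rfl, rfl⟩ : i = 1 ∧ j = 2 ∧ k = 1 := by omega
      -- Of the four two-letter prefixes, `λρ` is the excluded one.
      cases a <;> cases b <;> first | exact absurd rfl hne | decide
    | _ :: _ :: _ :: _, h, _ =>
      simp only [List.length_cons] at h
      omega
  · intro h
    simp only [freeGens₆, List.mem_cons, List.not_mem_nil, or_false] at h
    rcases h with rfl | rfl | rfl | rfl | rfl | rfl | rfl | rfl | rfl | rfl | rfl | rfl | rfl |
      rfl | rfl <;> rw [isFreeGen_sym] <;> decide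

/-- For at most six letters the fundamental group is free. -/
noncomputable def fundamentalIsoFree {n : ℕ} (hn : 1 ≤ n) (hn' : n ≤ 6) {l : List Gen}
    (hl : l.Nodup) (h : ∀ g, IsFreeGen n g ↔ g ∈ l) :
    fundamental n ≅ deloop (FreeGroup (Fin l.length)) :=
  fundamentalIso hn ≪≫ deloopIso ((presEquivFree hn').trans
    (FreeGroup.freeGroupCongr (equivFin l hl h)))

theorem mem_nil_iff (g : Gen) : IsFreeGen 3 g ↔ g ∈ ([] : List Gen) :=
  ⟨fun h => absurd (h.1.middle_eq_one le_rfl) h.2.1, fun h => absurd h List.not_mem_nil⟩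

/-- A group with one element is isomorphic to the trivial group. -/
def equivUnit (H : Type) [Group H] [Unique H] : H ≃* Unit where
  toFun _ := ()
  invFun _ := 1
  left_inv _ := Subsingleton.elim _ _
  right_inv _ := rfl
  map_mul' _ _ := rfl

end Catalan

theorem mainTheorem6 :
    (∀ n : ℕ, 1 ≤ n →
      ∃ e : Catalan.fundamental n ≅ Catalan.deloop (PresentedGroup (Catalan.R n)),
        ∀ (g : Catalan.G n) (x y : Catalan.A n) (f : x ⟶ y), Catalan.IsEdge g.1 f →
          Catalan.deloop.elem ((Catalan.proj n ⋙ e.hom.toFunctor).map f) =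
            PresentedGroup.of g) ∧
    Nonempty (Catalan.fundamental 3 ≅ Catalan.deloop Unit) ∧
    Nonempty (Catalan.fundamental 4 ≅ Catalan.deloop (Multiplicative ℤ)) ∧
    Nonempty (Catalan.fundamental 5 ≅ Catalan.deloop (FreeGroup (Fin 5))) ∧
    Nonempty (Catalan.fundamental 6 ≅ Catalan.deloop (FreeGroup (Fin 15))) := by
  refine ⟨fun n hn => ⟨Catalan.fundamentalIso hn, fun g x y f hf =>
    Catalan.deloop_elem_proj hn g f hf⟩, ⟨?_⟩, ⟨?_⟩, ⟨?_⟩, ⟨?_⟩⟩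
  -- The lists have 0, 1, 5 and 15 entries; the first two ranks give the trivial group and `ℤ`.
  · exact Catalan.fundamentalIsoFree (by norm_num) (by norm_num) List.nodup_nil
      Catalan.mem_nil_iff ≪≫ Catalan.deloopIso (Catalan.equivUnit (FreeGroup (Fin 0)))
  · exact Catalan.fundamentalIsoFree (by norm_num) (by norm_num) (by decide)
      Catalan.mem_freeGens₄ ≪≫ Catalan.deloopIso
        (FreeGroup.mulEquivIntOfUnique (α := Fin 1))
  · exact Catalan.fundamentalIsoFree (by norm_num) (by norm_num) (by decide)
      Catalan.mem_freeGens₅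
  · exact Catalan.fundamentalIsoFree (by norm_num) (by norm_num) (by decide)
      Catalan.mem_freeGens₆
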